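/- Let $d\ge 1$ and $k\ge d+1$, let ${\bf v}^{(1)},\dots,{\bf v}^{(k)}\in\mathbb Z^d$ and let $U$ be a unitary $k\times k$ matrix; these data specify a quantum walk on $\mathbb Z^d$ with $k$ chiralities. For ${\bf x}=(x_1,\dots,x_d)$ let $M({\bf x})$ be the diagonal matrix with entries ${\bf x}^{{\bf v}^{(1)}},\dots,{\bf x}^{{\bf v}^{(k)}}$, and let $$Q({\bf x},y)=\det\bigl(I-y\,M({\bf x})\,U\bigr)$$ be the denominator of the generating function of the walk. Write ${\bf z}=(z_1,\dots,z_{d+1})=({\bf x},y)$, let $T^m=\{|z_1|=\dots=|z_m|=1\}\subset\mathbb C^m$, and let $\mathcal V_1=\{{\bf z}\in T^{d+1}: Q({\bf z})=0\}$. Assume that $\nabla Q$ vanishes nowhere on $\mathcal V_1$. Let $\pi:\mathcal V_1\to T^d$ be the projection that forgets the last coordinate. Then: 1. $\partial Q/\partial y$ does not vanish on $\mathcal V_1$. 2. $\mathcal V_1$ is a compact (embedded, smooth) $d$-manifold. 3. $\pi:\mathcal V_1\to T^d$ is smooth and nonsingular, i.e. its differential is bijective at every point. 4. $\mathcal V_1$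 is homeomorphic to a disjoint union of some finite number $s$ of $d$-tori, each of which is mapped smoothly to $T^d$ by $\pi$, the $j$-th one covering $T^d$ a finite number $n_j\ge 1$ of times. Moreover, the logarithmic Gauss map ${\bf z}\mapsto\bigl(z_1\frac{\partial Q}{\partial z_1}:\dots:z_{d+1}\frac{\partial Q}{\partial z_{d+1}}\bigr)\in\mathbb{CP}^d$ is defined on $\mathcal V_1$, and under the identification $(a_1:\dots:a_d:b)\leftrightarrow(a_1/b,\dots,a_d/b)$ it is a smooth map $\mu:\mathcal V_1\to\mathbb R^d$. The set $-i\log\mathcal V_1=\{\theta\in\mathbb R^{d+1}:(e^{i\theta_1},\dots,e^{i\theta_{d+1}})\in\mathcal V_1\}$ has a smooth field of unit normals. For every such field, let $\kappa({\bf z})$ be the Gauss--Kronecker curvature of the real hypersurface $-i\log\mathcal V_1$ at a point $\theta$ with $e^{i\theta}={\bf z}$, that is, the determinant of the differential at $\theta$ of the map taking a point to its unit normal (whichever such $\theta$ is taken). Then, for ${\bf z}\in\mathcal V_1$: 5. $\kappa({\bf z})=0$ if and only if the determinant of the Jacobian of $\mu:\mathcal V_1\to\mathbb R^d$ vanishes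 at ${\bf z}$. 6. If $\mu({\bf z})$ lies on the boundary of $\mu[\mathcal V_1]$ in $\mathbb R^d$, then $\kappa({\bf z})=0$. -/

import Mathlib

open scoped Manifold ContDiff

noncomputable section

/-- A lattice quantum walk in dimension `d` with `k` chiralities: the increments
`v⁽¹⁾, …, v⁽ᵏ⁾ ∈ ℤᵈ` and the unitary coin matrix `U` of size `k`. -/
structure QuantumWalk (d k : ℕ) where
  step : Fin k → Fin d → ℤ
  coin : Matrix.unitaryGroup (Fin k) ℂ

/-- The torus `Tᵐ = {|z₁| = ⋯ = |z_m| = 1}`. -/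
abbrev Torus (m : ℕ) : Type := Fin m → Circle

/-- The model with corners of the torus, a product of circles. -/
abbrev torusModel (m : ℕ) :
    ModelWithCorners ℝ (Fin m → EuclideanSpace ℝ (Fin 1))
      (ModelPi fun _ : Fin m => EuclideanSpace ℝ (Fin 1)) :=
  ModelWithCorners.pi fun _ : Fin m => 𝓡 1

/-- The inclusion `Tᵐ ⊂ ℂᵐ`. -/
def torusIncl {m : ℕ} (z : Torus m) : Fin m → ℂ := fun i => (z i : ℂ)

/-- The map `θ ↦ (e^{iθ₁}, …, e^{iθ_m})` from `ℝᵐ` onto `Tᵐ`. -/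
def torusExp {m : ℕ} (θ : EuclideanSpace ℝ (Fin m)) : Torus m := fun i => Circle.exp (θ i)

/-! ### Gauss–Kronecker curvature of a hypersurface in Euclidean space -/

section Curvature

variable {E : Type*} [NormedAddCommGroup E] [InnerProductSpace ℝ E] [FiniteDimensional ℝ E]

/-- The tangent space at `p` of a submanifold `S` of a Euclidean space. -/
def tangentSpaceOf (S : Set E) (p : E) : Submodule ℝ E :=
  Submodule.span ℝ (tangentConeAt ℝ S p)

/-- `N` is a smooth field of unit normals along the hypersurface `S`. -/
structure IsUnitNormalField (S : Set E) (N : E → E) : Prop where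
  smooth : ContDiffOn ℝ ∞ N S
  norm_eq_one : ∀ p ∈ S, ‖N p‖ = 1
  normal : ∀ p ∈ S, ∀ w ∈ tangentSpaceOf S p, inner ℝ (N p) w = 0

/-- The differential at `p` of the Gauss map `N : S → unit sphere`, as an endomorphism of the
tangent space `T_p S`. (The derivative within `S` is determined on `T_p S`, and it takes its
values in `N(p)^⊥ = T_p S`, where the projection does nothing.) -/
def gaussDifferential (S : Set E) (N : E → E) (p : E) :
    tangentSpaceOf S p →ₗ[ℝ] tangentSpaceOf S p :=
  ((tangentSpaceOf S p).orthogonalProjectionOnto ∘L fderivWithin ℝ N S p ∘L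
    (tangentSpaceOf S p).subtypeL).toLinearMap

/-- The Gauss–Kronecker curvature at `p` of the hypersurface `S` oriented by `N`: the determinant
of the differential of the map that takes a point to its unit normal. -/
def gaussKroneckerCurvature (S : Set E) (N : E → E) (p : E) : ℝ :=
  LinearMap.det (gaussDifferential S N p)

end Curvature

/-- The point `(r₁ : ⋯ : r_d : 1)` of complex projective space, for `r ∈ ℝᵈ`. -/
def affinePoint {d : ℕ} (r : EuclideanSpace ℝ (Fin d)) :
    Projectivization ℂ (Fin (d + 1) → ℂ) :=
  Projectivization.mk ℂ (Fin.snoc (α := fun _ => ℂ) (fun j => ((r j : ℝ) : ℂ)) 1) (by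
    intro h
    have := congrFun h (Fin.last d)
    simp at this)

namespace QuantumWalk

variable {d k : ℕ} (W : QuantumWalk d k)

/-- The diagonal matrix `M(x)` with entries `x^{v⁽¹⁾}, …, x^{v⁽ᵏ⁾}`; here and below, a point
`z ∈ ℂ^{d+1}` stands for `(x₁, …, x_d, y)`. -/
def stepMatrix (z : Fin (d + 1) → ℂ) : Matrix (Fin k) (Fin k) ℂ :=
  Matrix.diagonal fun j => ∏ i : Fin d, z i.castSucc ^ W.step j i

/-- The denominator `Q(x, y) = det (I - y M(x) U)` of the generating function of the walk. -/
def Q (z : Fin (d + 1) → ℂ) : ℂ :=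
  (1 - z (Fin.last d) • (W.stepMatrix z * (W.coin : Matrix (Fin k) (Fin k) ℂ))).det

/-- The gradient `∇Q = (∂Q/∂z₁, …, ∂Q/∂z_{d+1})`. -/
def gradQ (z : Fin (d + 1) → ℂ) : Fin (d + 1) → ℂ :=
  fun i => fderiv ℂ W.Q z (Pi.single i 1)

/-- The logarithmic gradient `(z₁ ∂Q/∂z₁, …, z_{d+1} ∂Q/∂z_{d+1})`. -/
def logGradQ (z : Fin (d + 1) → ℂ) : Fin (d + 1) → ℂ :=
  fun i => z i * W.gradQ z i

/-- `𝒱₁`, the set of zeros of `Q` on the unit torus `T^{d+1}`. -/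
def V₁ : Set (Torus (d + 1)) := {z | W.Q (torusIncl z) = 0}

/-- The smoothness hypothesis: `∇Q` vanishes nowhere on `𝒱₁`. -/
def SmoothnessHypothesis : Prop := ∀ z ∈ W.V₁, W.gradQ (torusIncl z) ≠ 0

/-- The projection `π : 𝒱₁ → Tᵈ` that forgets the last coordinate. -/
def proj (z : W.V₁) : Torus d := fun i => (z : Torus (d + 1)) i.castSucc

/-- The logarithmic Gauss map `(z₁ ∂Q/∂z₁ : ⋯ : z_{d+1} ∂Q/∂z_{d+1})` with values in `ℂℙᵈ`. -/
def projGaussMap (z : Fin (d + 1) → ℂ) (h : W.logGradQ z ≠ 0) :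
    Projectivization ℂ (Fin (d + 1) → ℂ) :=
  Projectivization.mk ℂ (W.logGradQ z) h

/-- The logarithmic Gauss map as a map `μ : 𝒱₁ → ℝᵈ`, through the identification of
`(a₁ : ⋯ : a_d : b)` with `(a₁/b, …, a_d/b)`, which has real coordinates on `𝒱₁`. -/
def gaussMap (z : W.V₁) : EuclideanSpace ℝ (Fin d) :=
  WithLp.toLp 2 fun j =>
    (W.logGradQ (torusIncl z) j.castSucc / W.logGradQ (torusIncl z) (Fin.last d)).re

/-- The determinant of the Jacobian of `μ : 𝒱₁ → ℝᵈ` at `z`, in the preferred chart at `z`. -/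
def gaussJacobian [ChartedSpace (EuclideanSpace ℝ (Fin d)) W.V₁] (z : W.V₁) : ℝ :=
  ContinuousLinearMap.det
    (show EuclideanSpace ℝ (Fin d) →L[ℝ] EuclideanSpace ℝ (Fin d) from
      mfderiv (𝓡 d) 𝓘(ℝ, EuclideanSpace ℝ (Fin d)) W.gaussMap z)

/-- The real hypersurface `-i log 𝒱₁ ⊂ ℝ^{d+1}`, taken with all branches of the logarithm. -/
def logV₁ : Set (EuclideanSpace ℝ (Fin (d + 1))) := {θ | torusExp θ ∈ W.V₁}

end QuantumWalk

end

/-! Put V = yM(x)U, which is unitary on the torus. By Jacobi's formula ∇Q is built from the entries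
of adj(1 - V), so on 𝒱₁ smoothness forces adj(1 - V) ≠ 0, i.e. 1 - V has corank one. Since V is
unitary, left and right null vectors of 1 - V are conjugate, so adj(1 - V) is a nonzero multiple of
vv* and has nonzero trace (`Matrix.trace_adjugate_one_sub_ne_zero`). That trace is -y ∂Q/∂y.

Unitarity also makes Q real on the torus up to a smooth unimodular factor. Removing the factor gives
a real defining function of -i log 𝒱₁ (`exists_real_defining_function`), so the logarithmic gradient
is a complex multiple of a real vector. The implicit function theorem then presents -i log 𝒱₁
locally as a graph y = g(x) with ∇g = -μ (`exists_local_graph`). Hence π is a local homeomorphism;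
the angles of π(z) serve as charts, with translations as transition maps.

By compactness π is a covering. Its components correspond to ℤᵈ-orbits of lifts of ℝᵈ → Tᵈ, and the
stabilizers are lattices of finite index, so each component is a torus
(`exists_homeomorph_sigma_torus`).

The normal of the graph is proportional to (μ, 1). Modulo the normal direction, its derivative along
the graph is a nonzero multiple of dμ, so κ and the Jacobian determinant vanish together. Where the
Jacobian determinant is nonzero, μ is locally open, and so its value is not on the boundary of the
image. -/

section

open Matrix Set Filter

/-! ### The adjugate of 1 - V and the derivative of a determinant. -/

section Adjugate

variable {n : Type*} [Fintype n] [DecidableEq n]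

/-- If the cofactor at `(i, j)` does not vanish, a vector of the kernel is determined by its
`i`-th coordinate. -/
theorem Matrix.eq_zero_of_mulVec_eq_zero_of_adjugate_ne_zero {B : Matrix n n ℂ} {i j : n}
    (h : B.adjugate i j ≠ 0) {v : n → ℂ} (hv : B *ᵥ v = 0) (hi : v i = 0) : v = 0 := by
  by_contra hne
  refine h ?_
  rw [adjugate_apply, ← exists_mulVec_eq_zero_iff]
  refine ⟨v, hne, ?_⟩
  ext l
  by_cases hl : l = j
  · subst hl
    simp [mulVec, hi]
  · have := congrFun hv l
    simpa [mulVec, updateRow_ne hl] using this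

/-- The kernel of 1 - V is a line spanned by a column of the adjugate. Unitarity puts the conjugate
of a row in the same line, so the trace is, up to a nonzero factor, the squared norm of a nonzero
row. -/
theorem Matrix.trace_adjugate_one_sub_ne_zero {V : Matrix n n ℂ} (hV : V ∈ unitaryGroup n ℂ)
    (hdet : (1 - V).det = 0) (h : (1 - V).adjugate ≠ 0) : (1 - V).adjugate.trace ≠ 0 := by
  set B := 1 - V with hB
  set C := B.adjugate with hC
  obtain ⟨i, j, hij⟩ : ∃ i j, C i j ≠ 0 := by
    by_contra! h'
    exact h (by ext i j; exact h' i j)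
  have key : ∀ v : n → ℂ, B *ᵥ v = 0 → ∀ l, v l * C i j = v i * C l j := by
    intro v hv l
    have hcol : B *ᵥ (fun l => C l j) = 0 := by
      have : B * C = 0 := by rw [hC, mul_adjugate, hdet, zero_smul]
      ext l
      exact congrFun (congrFun this l) j
    -- The combination is chosen so that its `i`-th coordinate cancels.
    have hw : B *ᵥ (C i j • v - v i • fun l => C l j) = 0 := by
      rw [mulVec_sub, mulVec_smul, mulVec_smul, hv, hcol]; simp
    have := congrFun (eq_zero_of_mulVec_eq_zero_of_adjugate_ne_zero hij hw
      (by simp [mul_comm])) l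
    simp only [Pi.sub_apply, Pi.smul_apply, smul_eq_mul, Pi.zero_apply] at this
    linear_combination this
  have hcols : ∀ l m, C l m * C i j = C i m * C l j := by
    intro l m
    refine key (fun l => C l m) ?_ l
    have : B * C = 0 := by rw [hC, mul_adjugate, hdet, zero_smul]
    ext l
    exact congrFun (congrFun this l) m
  -- A row vector fixed by V has conjugate fixed by V*, hence by V = (V*)⁻¹.
  have hrow : B *ᵥ star (C i) = 0 := by
    have h1 : C i ᵥ* B = 0 := by
      have : C * B = 0 := by rw [hC, adjugate_mul, hdet, zero_smul]
      ext l
      exact congrFun (congrFun this i) l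
    rw [hB, vecMul_sub, vecMul_one, sub_eq_zero] at h1
    have h2 : star V *ᵥ star (C i) = star (C i) := by
      conv_rhs => rw [h1]
      rw [star_vecMul]; rfl
    have h3 : V *ᵥ star (C i) = star (C i) := by
      conv_lhs => rw [← h2]
      rw [mulVec_mulVec, mem_unitaryGroup_iff.1 hV, one_mulVec]
    rw [hB, sub_mulVec, one_mulVec, h3, sub_self]
  intro ht
  -- This identity trades the trace for the squared norm of row `i`; a zero trace would then kill
  -- that row, although it contains `C i j ≠ 0`.
  have h1 : C.trace * C i j * star (C i i) = (∑ l, C i l * star (C i l)) * C i j := by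
    rw [trace, Finset.sum_mul, Finset.sum_mul, Finset.sum_mul]
    refine Finset.sum_congr rfl fun l _ => ?_
    have := key _ hrow l
    simp only [Pi.star_apply] at this
    rw [diag_apply, hcols, mul_assoc, mul_assoc, this, mul_comm (C l j)]
  rw [ht, zero_mul, zero_mul, eq_comm, mul_eq_zero, or_iff_left hij] at h1
  have h2 : ∑ l, ‖C i l‖ ^ 2 = 0 := by
    have : ((∑ l, ‖C i l‖ ^ 2 : ℝ) : ℂ) = 0 := by
      rw [← h1]
      push_cast
      exact Finset.sum_congr rfl fun l _ => by simp [Complex.mul_conj']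
    exact_mod_cast this
  rw [Finset.sum_eq_zero_iff_of_nonneg fun _ _ => by positivity] at h2
  exact hij (by simpa using h2 j (Finset.mem_univ j))

/-- Jacobi's formula. -/
theorem HasFDerivAt.matrix_det {𝕜 E : Type*} [NontriviallyNormedField 𝕜] [NormedAddCommGroup E]
    [NormedSpace 𝕜 E] {B : E → Matrix n n 𝕜} {B' : n → n → E →L[𝕜] 𝕜} {z : E}
    (hB : ∀ i j, HasFDerivAt (fun z => B z i j) (B' i j) z) :
    HasFDerivAt (fun z => (B z).det) (∑ i, ∑ j, (B z).adjugate j i • B' i j) z := by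
  let D : ContinuousMultilinearMap 𝕜 (fun _ : n => n → 𝕜) 𝕜 :=
    ⟨(Matrix.detRowAlternating (R := 𝕜) (n := n)).toMultilinearMap, continuous_id.matrix_det⟩
  have hBz : HasFDerivAt (fun z => (B z : n → n → 𝕜))
      (ContinuousLinearMap.pi fun i => ContinuousLinearMap.pi fun j => B' i j) z :=
    hasFDerivAt_pi.2 fun i => hasFDerivAt_pi.2 fun j => hB i j
  refine ((D.hasFDerivAt (x := B z)).comp z hBz).congr_fderiv ?_
  ext w
  refine (ContinuousMultilinearMap.linearDeriv_apply D (B z) fun i j => B' i j w).trans ?_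
  rw [_root_.sum_apply]
  refine Finset.sum_congr rfl fun i _ => ?_
  -- The `i`-th term replaces row `i` by its derivative; Cramer's rule expands it along that row in
  -- cofactors.
  change ((B z).updateRow i fun j => B' i j w).det = _
  rw [← cramer_transpose_apply, cramer_eq_adjugate_mulVec, ← adjugate_transpose]
  simp [mulVec, dotProduct]

end Adjugate

/-! ### Analyticity of Q and the nonvanishing of y ∂Q/∂y on 𝒱₁. -/

namespace QuantumWalk

variable {d k : ℕ} (W : QuantumWalk d k)

theorem analyticAt_stepMatrix {z : Fin (d + 1) → ℂ} (hz : ∀ i, z i ≠ 0) (i j : Fin k) :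
    AnalyticAt ℂ (fun z => W.stepMatrix z i j) z := by
  by_cases h : i = j
  · subst h
    simp only [stepMatrix, diagonal_apply_eq]
    refine Finset.analyticAt_fun_prod _ fun l _ => AnalyticAt.fun_zpow ?_ (hz _)
    exact (ContinuousLinearMap.proj (R := ℂ) (φ := fun _ : Fin (d + 1) => ℂ)
      l.castSucc).analyticAt z
  · simp only [stepMatrix, diagonal_apply_ne _ h]
    exact analyticAt_const

theorem analyticAt_one_sub_smul {z : Fin (d + 1) → ℂ} (hz : ∀ i, z i ≠ 0) (i j : Fin k) :
    AnalyticAt ℂ (fun z : Fin (d + 1) → ℂ => (1 - z (Fin.last d) •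
      (W.stepMatrix z * (W.coin : Matrix (Fin k) (Fin k) ℂ))) i j) z := by
  simp only [Matrix.sub_apply, Matrix.smul_apply, mul_apply, smul_eq_mul]
  refine analyticAt_const.sub (AnalyticAt.mul ?_ ?_)
  · exact (ContinuousLinearMap.proj (R := ℂ) (φ := fun _ : Fin (d + 1) => ℂ)
      (Fin.last d)).analyticAt z
  · exact Finset.analyticAt_fun_sum _ fun l _ =>
      (W.analyticAt_stepMatrix hz i l).mul analyticAt_const

theorem analyticAt_Q {z : Fin (d + 1) → ℂ} (hz : ∀ i, z i ≠ 0) : AnalyticAt ℂ W.Q z := by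
  unfold Q
  simp only [det_apply', ]
  exact Finset.analyticAt_fun_sum _ fun σ _ => analyticAt_const.mul
    (Finset.analyticAt_fun_prod _ fun i _ => W.analyticAt_one_sub_smul hz _ _)

theorem analyticAt_gradQ {z : Fin (d + 1) → ℂ} (hz : ∀ i, z i ≠ 0) (i : Fin (d + 1)) :
    AnalyticAt ℂ (fun z => W.gradQ z i) z :=
  ((ContinuousLinearMap.apply ℂ ℂ (Pi.single i 1 : Fin (d + 1) → ℂ)).analyticAt _).comp
    (W.analyticAt_Q hz).fderiv

theorem analyticAt_logGradQ {z : Fin (d + 1) → ℂ} (hz : ∀ i, z i ≠ 0) (i : Fin (d + 1)) :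
    AnalyticAt ℂ (fun z => W.logGradQ z i) z :=
  ((ContinuousLinearMap.proj (R := ℂ) (φ := fun _ : Fin (d + 1) => ℂ) i).analyticAt z).mul
    (W.analyticAt_gradQ hz i)

theorem gradQ_eq_zero_of_adjugate_eq_zero {z : Fin (d + 1) → ℂ} (hz : ∀ i, z i ≠ 0)
    (h : (1 - z (Fin.last d) •
      (W.stepMatrix z * (W.coin : Matrix (Fin k) (Fin k) ℂ))).adjugate = 0) :
    W.gradQ z = 0 := by
  have := HasFDerivAt.matrix_det fun i j =>
    (W.analyticAt_one_sub_smul hz i j).differentiableAt.hasFDerivAt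
  ext i
  rw [gradQ, show W.Q = _ from rfl]
  unfold Q
  rw [this.fderiv, h]
  simp

/-- Jacobi's formula on the line in direction y gives y ∂Q/∂y = -tr(adj(1 - V) V), and adj(1 - V)(1
- V) = Q = 0 absorbs the factor V. -/
theorem logGradQ_last {z : Fin (d + 1) → ℂ} (hz : ∀ i, z i ≠ 0) (hQ : W.Q z = 0) :
    W.logGradQ z (Fin.last d) = -(1 - z (Fin.last d) •
      (W.stepMatrix z * (W.coin : Matrix (Fin k) (Fin k) ℂ))).adjugate.trace := by
  set A := W.stepMatrix z * (W.coin : Matrix (Fin k) (Fin k) ℂ) with hA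
  set y := z (Fin.last d) with hy
  have hline : ∀ t : ℂ, W.Q (z + t • Pi.single (Fin.last d) 1) = (1 - (y + t) • A).det := by
    intro t
    have : W.stepMatrix (z + t • Pi.single (Fin.last d) 1) = W.stepMatrix z := by
      unfold stepMatrix
      congr 1
      ext j
      refine Finset.prod_congr rfl fun i _ => ?_
      simp [(Fin.castSucc_lt_last i).ne]
    rw [Q, this]
    simp [hy, hA]
  have h1 : HasFDerivAt (fun t : ℂ => (1 - (y + t) • A).det)
      (∑ i, ∑ j, (1 - (y + 0) • A).adjugate j i •
        (ContinuousLinearMap.toSpanSingleton ℂ (-A i j))) 0 := by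
    refine HasFDerivAt.matrix_det fun i j => ?_
    have : HasDerivAt (fun t : ℂ => (1 - (y + t) • A) i j) (-A i j) 0 := by
      simp only [Matrix.sub_apply, Matrix.smul_apply, smul_eq_mul]
      simpa using (((hasDerivAt_id (0 : ℂ)).const_add y).mul_const (A i j)).const_sub
        ((1 : Matrix (Fin k) (Fin k) ℂ) i j)
    exact this.hasFDerivAt
  have h2 : W.gradQ z (Fin.last d) = -((1 - y • A).adjugate * A).trace := by
    rw [gradQ, ← (W.analyticAt_Q hz).differentiableAt.lineDeriv_eq_fderiv, lineDeriv,
      funext hline, h1.hasDerivAt.deriv]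
    simp only [add_zero, _root_.sum_apply, _root_.smul_apply,
      ContinuousLinearMap.toSpanSingleton_apply, one_mul, smul_eq_mul, trace, diag_apply,
      mul_apply, mul_neg, Finset.sum_neg_distrib]
    rw [Finset.sum_comm]
  have h3 : (1 - y • A).adjugate * (1 - y • A) = 0 := by
    rw [adjugate_mul, show (1 - y • A).det = 0 from hQ, zero_smul]
  rw [mul_sub, mul_one, Matrix.mul_smul, sub_eq_zero] at h3
  rw [logGradQ, h2, ← hy]
  conv_rhs => rw [h3, trace_smul]
  simp

theorem torusIncl_ne_zero {m : ℕ} (z : Torus m) (i : Fin m) : torusIncl z i ≠ 0 :=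
  (z i).coe_ne_zero

theorem continuous_torusIncl {m : ℕ} : Continuous (torusIncl (m := m)) :=
  continuous_pi fun i => continuous_subtype_val.comp (continuous_apply i)

theorem stepMatrix_mem_unitaryGroup (z : Torus (d + 1)) :
    W.stepMatrix (torusIncl z) ∈ unitaryGroup (Fin k) ℂ := by
  rw [mem_unitaryGroup_iff, stepMatrix, star_eq_conjTranspose, diagonal_conjTranspose,
    diagonal_mul_diagonal, ← diagonal_one]
  congr 1
  ext j
  rw [Pi.star_apply, star_prod, ← Finset.prod_mul_distrib]
  refine Finset.prod_eq_one fun i _ => ?_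
  rw [torusIncl, star_zpow₀, ← mul_zpow, Complex.star_def, ← Circle.coe_inv_eq_conj,
    ← Circle.coe_mul, mul_inv_cancel, Circle.coe_one, _root_.one_zpow]

theorem smul_mem_unitaryGroup (z : Torus (d + 1)) :
    torusIncl z (Fin.last d) • (W.stepMatrix (torusIncl z) *
      (W.coin : Matrix (Fin k) (Fin k) ℂ)) ∈ unitaryGroup (Fin k) ℂ := by
  have h := mul_mem (W.stepMatrix_mem_unitaryGroup z) W.coin.2
  rw [mem_unitaryGroup_iff] at h ⊢
  rw [star_smul, smul_mul_smul_comm, h, torusIncl, Complex.star_def, ← Circle.coe_inv_eq_conj,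
    ← Circle.coe_mul, mul_inv_cancel, Circle.coe_one, one_smul]

variable {W} in
theorem SmoothnessHypothesis.logGradQ_last_ne_zero (hW : W.SmoothnessHypothesis)
    {z : Torus (d + 1)} (hz : z ∈ W.V₁) : W.logGradQ (torusIncl z) (Fin.last d) ≠ 0 := by
  rw [W.logGradQ_last (torusIncl_ne_zero z) hz, neg_ne_zero]
  refine trace_adjugate_one_sub_ne_zero (W.smul_mem_unitaryGroup z) hz fun h => ?_
  exact hW z hz (W.gradQ_eq_zero_of_adjugate_eq_zero (torusIncl_ne_zero z) h)

variable {W} in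
theorem SmoothnessHypothesis.gradQ_last_ne_zero (hW : W.SmoothnessHypothesis)
    {z : Torus (d + 1)} (hz : z ∈ W.V₁) : W.gradQ (torusIncl z) (Fin.last d) ≠ 0 :=
  right_ne_zero_of_mul (hW.logGradQ_last_ne_zero hz)

theorem isCompact_V₁ : IsCompact W.V₁ := by
  refine IsClosed.isCompact ?_
  have : Continuous fun z : Torus (d + 1) => W.Q (torusIncl z) :=
    continuous_iff_continuousAt.2 fun z =>
      (W.analyticAt_Q (torusIncl_ne_zero z)).continuousAt.comp continuous_torusIncl.continuousAt
  exact isClosed_singleton.preimage this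

/-- The reflection of `Q` on the torus: `conj Q = (-1)ᵏ conj (det V) Q`, where `V = y M(x) U`. -/
theorem star_Q (z : Torus (d + 1)) :
    star (W.Q (torusIncl z)) = (-1) ^ k * star (torusIncl z (Fin.last d) • (W.stepMatrix
      (torusIncl z) * (W.coin : Matrix (Fin k) (Fin k) ℂ))).det * W.Q (torusIncl z) := by
  set V := torusIncl z (Fin.last d) • (W.stepMatrix (torusIncl z) *
    (W.coin : Matrix (Fin k) (Fin k) ℂ)) with hV
  have hu : star V * V = 1 := mem_unitaryGroup_iff'.1 (W.smul_mem_unitaryGroup z)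
  rw [Q, ← hV, ← det_conjTranspose, ← det_conjTranspose, conjTranspose_sub, conjTranspose_one,
    ← star_eq_conjTranspose, show (1 : Matrix (Fin k) (Fin k) ℂ) - star V
      = -(star V * (1 - V)) by rw [mul_sub, hu, mul_one]; abel, det_neg, det_mul,
    Fintype.card_fin, mul_assoc]

end QuantumWalk

end

/-! ### Angular coordinates, the real defining function and local graphs. -/

noncomputable section

open scoped Topology
open Filter

/-- The linear isomorphism `ℝᵈ × ℝ ≃ ℝ^{d+1}` that appends the last coordinate. -/
def snocEquiv (d : ℕ) :
    (EuclideanSpace ℝ (Fin d) × ℝ) ≃L[ℝ] EuclideanSpace ℝ (Fin (d + 1)) :=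
  LinearEquiv.toContinuousLinearEquiv
    { toFun := fun p => WithLp.toLp 2 (Fin.snoc (α := fun _ => ℝ) p.1 p.2)
      invFun := fun θ => (WithLp.toLp 2 fun i => θ i.castSucc, θ (Fin.last d))
      map_add' := fun p q => by
        ext i
        induction i using Fin.lastCases <;> simp
      map_smul' := fun c p => by
        ext i
        induction i using Fin.lastCases <;> simp
      left_inv := fun p => by
        ext <;> simp
      right_inv := fun θ => by
        ext i
        induction i using Fin.lastCases <;> simp }

section Snoc

variable {d : ℕ}

@[simp]
theorem snocEquiv_castSucc (p : EuclideanSpace ℝ (Fin d) × ℝ) (i : Fin d) :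
    snocEquiv d p i.castSucc = p.1 i :=
  Fin.snoc_castSucc (α := fun _ => ℝ) p.2 p.1 i

@[simp]
theorem snocEquiv_last (p : EuclideanSpace ℝ (Fin d) × ℝ) :
    snocEquiv d p (Fin.last d) = p.2 :=
  Fin.snoc_last (α := fun _ => ℝ) p.2 p.1

@[simp]
theorem snocEquiv_symm_snd (θ : EuclideanSpace ℝ (Fin (d + 1))) :
    ((snocEquiv d).symm θ).2 = θ (Fin.last d) := rfl

end Snoc

theorem torusIncl_torusExp {m : ℕ} (θ : EuclideanSpace ℝ (Fin m)) (i : Fin m) :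
    torusIncl (torusExp θ) i = Complex.exp (θ i * Complex.I) := Circle.coe_exp _

theorem contDiff_torusIncl_torusExp {m : ℕ} :
    ContDiff ℝ ∞ fun θ : EuclideanSpace ℝ (Fin m) => torusIncl (torusExp θ) := by
  refine contDiff_pi.2 fun i => ?_
  simp only [torusIncl_torusExp]
  have : ContDiff ℝ ∞ fun θ : EuclideanSpace ℝ (Fin m) => (θ i : ℂ) :=
    Complex.ofRealCLM.contDiff.comp (EuclideanSpace.proj (𝕜 := ℝ) i).contDiff
  exact (this.mul contDiff_const).cexp

theorem hasFDerivAt_torusIncl_torusExp {m : ℕ} (θ : EuclideanSpace ℝ (Fin m)) :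
    HasFDerivAt (fun θ : EuclideanSpace ℝ (Fin m) => torusIncl (torusExp θ))
      (ContinuousLinearMap.pi fun i => (torusIncl (torusExp θ) i * Complex.I) •
        (Complex.ofRealCLM ∘L EuclideanSpace.proj (𝕜 := ℝ) i)) θ := by
  refine hasFDerivAt_pi.2 fun i => ?_
  simp only [torusIncl_torusExp]
  have : HasFDerivAt (fun θ : EuclideanSpace ℝ (Fin m) => (θ i : ℂ))
      (Complex.ofRealCLM ∘L EuclideanSpace.proj (𝕜 := ℝ) i) θ :=
    (Complex.ofRealCLM ∘L EuclideanSpace.proj (𝕜 := ℝ) i).hasFDerivAt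
  refine ((this.mul_const Complex.I).cexp).congr_fderiv ?_
  rw [smul_smul]

theorem continuous_torusExp {m : ℕ} : Continuous (torusExp (m := m)) :=
  continuous_pi fun i => Circle.exp.continuous.comp (EuclideanSpace.proj (𝕜 := ℝ) i).continuous

namespace QuantumWalk

variable {d k : ℕ} (W : QuantumWalk d k)

theorem hasFDerivAt_Q_torusExp (θ : EuclideanSpace ℝ (Fin (d + 1))) :
    HasFDerivAt (fun θ => W.Q (torusIncl (torusExp θ)))
      (∑ i, (W.logGradQ (torusIncl (torusExp θ)) i * Complex.I) •
        (Complex.ofRealCLM ∘L EuclideanSpace.proj (𝕜 := ℝ) i)) θ := by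
  have h := ((W.analyticAt_Q (torusIncl_ne_zero (torusExp θ))).differentiableAt.hasFDerivAt
    |>.restrictScalars ℝ).comp θ (hasFDerivAt_torusIncl_torusExp θ)
  refine h.congr_fderiv ?_
  ext w
  simp only [ContinuousLinearMap.comp_apply, ContinuousLinearMap.coe_restrictScalars']
  rw [← ContinuousLinearMap.coe_coe, LinearMap.pi_apply_eq_sum_univ, _root_.sum_apply]
  refine Finset.sum_congr rfl fun i _ => ?_
  have : (fun j => if i = j then (1 : ℂ) else 0) = Pi.single i 1 := by
    ext j
    simp [Pi.single_apply, eq_comm]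
  rw [this]
  simp [logGradQ, gradQ]
  ring

/-- The factor relating Q to its conjugate is unimodular and, by multiplicativity of det, its
argument is affine in θ. It therefore has a global smooth square root. -/
theorem exists_phase : ∃ β : EuclideanSpace ℝ (Fin (d + 1)) → ℝ, ContDiff ℝ ∞ β ∧
    ∀ θ, star (W.Q (torusIncl (torusExp θ))) =
      Complex.exp (-2 * β θ * Complex.I) * W.Q (torusIncl (torusExp θ)) := by
  set D := (W.coin : Matrix (Fin k) (Fin k) ℂ).det with hD
  have hDn : ‖(-1) ^ k * star D‖ = 1 := by
    have := Matrix.det_of_mem_unitary W.coin.2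
    simp [CStarRing.norm_of_mem_unitary this, hD]
  obtain ⟨γ, hγ⟩ := (Complex.norm_eq_one_iff _).1 hDn
  -- The bracket is the argument of det(yM(x)), and γ is the argument of (-1)ᵏ conj(det U); -2β is
  -- their combined phase.
  refine ⟨fun θ => (k * θ (Fin.last d) + ∑ j, ∑ i : Fin d, W.step j i * θ i.castSucc) / 2 - γ / 2,
    ?_, fun θ => ?_⟩
  · have h : ∀ i, ContDiff ℝ ∞ fun θ : EuclideanSpace ℝ (Fin (d + 1)) => θ i := fun i =>
      (EuclideanSpace.proj (𝕜 := ℝ) i).contDiff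
    have := h (Fin.last d)
    have : ContDiff ℝ ∞ fun θ : EuclideanSpace ℝ (Fin (d + 1)) =>
        ∑ j, ∑ i : Fin d, (W.step j i : ℝ) * θ i.castSucc :=
      ContDiff.sum fun j _ => ContDiff.sum fun i _ => contDiff_const.mul (h _)
    fun_prop
  · rw [W.star_Q]
    congr 1
    rw [Matrix.det_smul, Matrix.det_mul, ← hD, star_mul, star_mul, ← mul_assoc, ← mul_assoc,
      ← hγ, stepMatrix, Matrix.det_diagonal, star_pow, star_prod]
    simp only [torusIncl_torusExp, Complex.star_def, ← Complex.exp_conj, map_mul,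
      Complex.conj_ofReal, Complex.conj_I, ← Complex.exp_int_mul, ← Complex.exp_sum,
      ← Complex.exp_nat_mul, Fintype.card_fin, ← Complex.exp_add]
    congr 1
    push_cast
    simp only [map_sum, map_mul, map_intCast, Complex.conj_ofReal, Complex.conj_I, mul_neg,
      Finset.sum_neg_distrib, ← mul_assoc, ← Finset.sum_mul]
    ring

/-- The real defining function of `-i log 𝒱₁`, obtained from `Q` by removing its phase. -/
theorem exists_real_defining_function : ∃ R : EuclideanSpace ℝ (Fin (d + 1)) → ℝ,
    ContDiff ℝ ∞ R ∧ (∀ θ, R θ = 0 ↔ θ ∈ W.logV₁) ∧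
    ∀ θ ∈ W.logV₁, ∃ c : ℂ, c ≠ 0 ∧ ∀ w, (fderiv ℝ R θ w : ℂ) =
      c * ∑ i, w i * W.logGradQ (torusIncl (torusExp θ)) i := by
  obtain ⟨β, hβ, h⟩ := W.exists_phase
  set F : EuclideanSpace ℝ (Fin (d + 1)) → ℂ := fun θ => W.Q (torusIncl (torusExp θ)) with hF
  set H : EuclideanSpace ℝ (Fin (d + 1)) → ℂ := fun θ => Complex.exp (-β θ * Complex.I) * F θ
    with hH
  have hFs : ContDiff ℝ ∞ F := contDiff_iff_contDiffAt.2 fun θ =>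
    ContDiffAt.comp (g := W.Q) θ
      ((W.analyticAt_Q (torusIncl_ne_zero (torusExp θ))).contDiffAt.restrict_scalars ℝ)
      contDiff_torusIncl_torusExp.contDiffAt
  have hβ' : ContDiff ℝ ∞ fun θ => (β θ : ℂ) := Complex.ofRealCLM.contDiff.comp hβ
  have hHs : ContDiff ℝ ∞ H := ((hβ'.neg.mul contDiff_const).cexp).mul hFs
  have hreal : ∀ θ, ((H θ).re : ℂ) = H θ := by
    intro θ
    rw [← Complex.conj_eq_iff_re, hH]
    simp only [map_mul, ← Complex.exp_conj, map_neg, Complex.conj_ofReal, Complex.conj_I]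
    rw [show (starRingEnd ℂ) (F θ) = _ from h θ, ← mul_assoc, ← Complex.exp_add]
    congr 2
    ring
  have hRs : ContDiff ℝ ∞ fun θ => (H θ).re := Complex.reCLM.contDiff.comp hHs
  refine ⟨fun θ => (H θ).re, hRs, fun θ => ?_, fun θ hθ => ?_⟩
  · rw [← Complex.ofReal_eq_zero, hreal, hH]
    simp [logV₁, V₁, hF]
  · refine ⟨Complex.exp (-β θ * Complex.I) * Complex.I, by simp, fun w => ?_⟩
    -- The derivative of `H` is computed twice: here from its real part, and below by the product
    -- rule.
    have h1 : HasFDerivAt H (Complex.ofRealCLM ∘L fderiv ℝ (fun θ => (H θ).re) θ) θ := by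
      have := Complex.ofRealCLM.hasFDerivAt.comp θ
        (hRs.differentiable (by simp) θ).hasFDerivAt
      exact this.congr_of_eventuallyEq (Eventually.of_forall fun x => (hreal x).symm)
    have h2 := ((hβ'.neg.mul contDiff_const).cexp.differentiable (by simp) θ).hasFDerivAt.mul
      (W.hasFDerivAt_Q_torusExp θ) (c := fun θ => Complex.exp (-(β θ : ℂ) * Complex.I))
    have h3 := DFunLike.congr_fun (h1.unique h2) w
    -- Since Q = 0 here, the derivative of the phase factor does not contribute.
    have h0 : W.Q (torusIncl (torusExp θ)) = 0 := hθ
    simp [h0] at h3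
    rw [h3, mul_assoc, Finset.mul_sum _ _ Complex.I, neg_mul]
    congr 1
    exact Finset.sum_congr rfl fun i _ => by ring

/-- The coordinates of the logarithmic Gauss map, as a function of the angles. -/
def slope (θ : EuclideanSpace ℝ (Fin (d + 1))) : EuclideanSpace ℝ (Fin d) :=
  WithLp.toLp 2 fun j => (W.logGradQ (torusIncl (torusExp θ)) j.castSucc /
    W.logGradQ (torusIncl (torusExp θ)) (Fin.last d)).re

variable {W}

theorem SmoothnessHypothesis.contDiffAt_slope (hW : W.SmoothnessHypothesis)
    {θ : EuclideanSpace ℝ (Fin (d + 1))} (hθ : θ ∈ W.logV₁) : ContDiffAt ℝ ∞ W.slope θ := by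
  refine contDiffAt_piLp' 2 fun j => ?_
  have h : ∀ i, ContDiffAt ℝ ∞ (fun θ => W.logGradQ (torusIncl (torusExp θ)) i) θ := fun i =>
    ContDiffAt.comp (g := fun z => W.logGradQ z i) θ
      ((W.analyticAt_logGradQ (torusIncl_ne_zero (torusExp θ)) i).contDiffAt.restrict_scalars ℝ)
      contDiff_torusIncl_torusExp.contDiffAt
  simp only [slope, div_eq_mul_inv]
  exact Complex.reCLM.contDiff.contDiffAt.comp θ
    ((h j.castSucc).mul ((h (Fin.last d)).inv (hW.logGradQ_last_ne_zero hθ)))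

/-- The ratios of logarithmic derivatives are ratios of partial derivatives of the real function
`R`, so taking real parts in `slope` loses nothing. -/
theorem SmoothnessHypothesis.logGradQ_castSucc (hW : W.SmoothnessHypothesis)
    {θ : EuclideanSpace ℝ (Fin (d + 1))} (hθ : θ ∈ W.logV₁) (j : Fin d) :
    W.logGradQ (torusIncl (torusExp θ)) j.castSucc =
      W.slope θ j * W.logGradQ (torusIncl (torusExp θ)) (Fin.last d) := by
  obtain ⟨R, -, -, hR⟩ := W.exists_real_defining_function
  obtain ⟨c, hc, h⟩ := hR θ hθ
  have hi : ∀ i, (fderiv ℝ R θ (EuclideanSpace.single i 1) : ℂ) =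
      c * W.logGradQ (torusIncl (torusExp θ)) i := by
    intro i
    rw [h]
    simp [apply_ite Complex.ofReal]
  have hL := hW.logGradQ_last_ne_zero hθ
  have : W.logGradQ (torusIncl (torusExp θ)) j.castSucc /
      W.logGradQ (torusIncl (torusExp θ)) (Fin.last d) =
      ((fderiv ℝ R θ (EuclideanSpace.single j.castSucc 1) /
        fderiv ℝ R θ (EuclideanSpace.single (Fin.last d) 1) : ℝ) : ℂ) := by
    push_cast
    rw [hi, hi, mul_div_mul_left _ _ hc]
  rw [← div_eq_iff hL, slope]
  simp only [this, Complex.ofReal_re]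

/-- Locally, `-i log 𝒱₁` is the graph of a smooth function, whose gradient is minus the
logarithmic Gauss map. -/
theorem SmoothnessHypothesis.exists_local_graph (hW : W.SmoothnessHypothesis)
    {p : EuclideanSpace ℝ (Fin d) × ℝ} (hp : snocEquiv d p ∈ W.logV₁) :
    ∃ g : EuclideanSpace ℝ (Fin d) → ℝ, ContDiffAt ℝ ∞ g p.1 ∧ g p.1 = p.2 ∧
      (∀ᶠ x in 𝓝 p.1, snocEquiv d (x, g x) ∈ W.logV₁ ∧
        HasFDerivAt g (-innerSL ℝ (W.slope (snocEquiv d (x, g x)))) x) ∧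
      ∀ᶠ q in 𝓝 p, snocEquiv d q ∈ W.logV₁ → g q.1 = q.2 := by
  obtain ⟨R, hRs, hR0, hR⟩ := W.exists_real_defining_function
  set f : EuclideanSpace ℝ (Fin d) × ℝ → ℝ := fun q => R (snocEquiv d q) with hf
  have hfs : ContDiff ℝ ∞ f := hRs.comp (snocEquiv d).contDiff
  have hfd : ∀ q w, fderiv ℝ f q w = fderiv ℝ R (snocEquiv d q) (snocEquiv d w) := by
    intro q w
    have := (hRs.differentiable (by simp) (snocEquiv d q)).hasFDerivAt.comp q
      (snocEquiv d).hasFDerivAt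
    rw [show f = R ∘ snocEquiv d from rfl, this.fderiv]
    rfl
  -- On the hypersurface df is a nonzero multiple of ⟨μ, dx⟩ + dy. This provides both the
  -- invertibility needed for the implicit function and the gradient -μ of that function.
  have hfw : ∀ q, snocEquiv d q ∈ W.logV₁ → ∃ a : ℝ, a ≠ 0 ∧ ∀ w : EuclideanSpace ℝ (Fin d) × ℝ,
      fderiv ℝ f q w = a * (inner ℝ (W.slope (snocEquiv d q)) w.1 + w.2) := by
    intro q hq
    obtain ⟨c, hc, h⟩ := hR _ hq
    have hL := hW.logGradQ_last_ne_zero hq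
    have key : ∀ w : EuclideanSpace ℝ (Fin d) × ℝ, (fderiv ℝ f q w : ℂ) =
        c * W.logGradQ (torusIncl (torusExp (snocEquiv d q))) (Fin.last d) *
          ((inner ℝ (W.slope (snocEquiv d q)) w.1 + w.2 : ℝ) : ℂ) := by
      intro w
      rw [hfd, h, Fin.sum_univ_castSucc, mul_assoc]
      congr 1
      simp only [hW.logGradQ_castSucc hq, snocEquiv_castSucc, snocEquiv_last, PiLp.inner_apply]
      push_cast
      rw [mul_add, Finset.mul_sum]
      congr 1
      · refine Finset.sum_congr rfl fun i _ => ?_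
        simp
        ring
      · ring
    refine ⟨fderiv ℝ f q (0, 1), ?_, fun w => ?_⟩
    · rw [← Complex.ofReal_ne_zero, key]
      simpa using ⟨hc, hL⟩
    · apply Complex.ofReal_injective
      rw [key, Complex.ofReal_mul, key]
      simp
  have hinv : (fderiv ℝ f p ∘L .inr ℝ (EuclideanSpace ℝ (Fin d)) ℝ).IsInvertible := by
    obtain ⟨a, ha, h⟩ := hfw p hp
    refine ⟨ContinuousLinearEquiv.unitsEquivAut ℝ (Units.mk0 a ha), ?_⟩
    ext
    simp [h]
  have hfp : f p = 0 := (hR0 _).2 hp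
  set g := hfs.contDiffAt.implicitFunction (u := p) (by simp) hinv with hg
  have hgs : ContDiffAt ℝ ∞ g p.1 := hfs.contDiffAt.contDiffAt_implicitFunction (by simp) hinv
  have hgp : g p.1 = p.2 := hfs.contDiffAt.implicitFunction_apply_self (by simp) hinv
  have hg0 : ∀ᶠ x in 𝓝 p.1, f (x, g x) = 0 := by
    filter_upwards [hfs.contDiffAt.eventually_apply_implicitFunction (u := p) (by simp) hinv]
      with x hx
    rw [← hfp, ← hx]
  refine ⟨g, hgs, hgp, ?_, ?_⟩
  · have hgd : ∀ᶠ x in 𝓝 p.1, DifferentiableAt ℝ g x :=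
      ((hgs.of_le (m := 1) (by simp)).eventually (by simp)).mono fun x hx =>
        hx.differentiableAt (by simp)
    filter_upwards [hg0.eventually_nhds, hgd] with x hx hd
    have hmem : snocEquiv d (x, g x) ∈ W.logV₁ := (hR0 _).1 hx.self_of_nhds
    refine ⟨hmem, ?_⟩
    obtain ⟨a, ha, h⟩ := hfw _ hmem
    refine hd.hasFDerivAt.congr_fderiv ?_
    ext w
    have h1 := (hfs.differentiable (by simp) (x, g x)).hasFDerivAt.comp x
      ((hasFDerivAt_id x).prodMk hd.hasFDerivAt)
    have h2 : HasFDerivAt (f ∘ fun x => (x, g x)) (0 : EuclideanSpace ℝ (Fin d) →L[ℝ] ℝ) x :=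
      HasFDerivAt.congr_of_eventuallyEq (f := fun _ => (0 : ℝ)) (hasFDerivAt_const _ _) hx
    have h3 := DFunLike.congr_fun (h1.unique h2) w
    simp only [ContinuousLinearMap.comp_apply, h, ContinuousLinearMap.prod_apply,
      ContinuousLinearMap.id_apply, _root_.zero_apply, mul_eq_zero, ha, false_or] at h3
    rw [_root_.neg_apply, innerSL_apply_apply]
    linarith
  · filter_upwards [hfs.contDiffAt.eventually_apply_eq_iff_implicitFunction (u := p) (by simp)
      hinv] with q hq hmem
    exact hq.1 (((hR0 _).2 hmem).trans hfp.symm)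

end QuantumWalk

end

/-! ### The universal covering of the torus and its compact coverings. -/

noncomputable section

open scoped Topology
open Filter Topology

section TorusExp

variable {m : ℕ}

/-- The period `2πn` of `torusExp`. -/
def torusPeriod (n : Fin m → ℤ) : EuclideanSpace ℝ (Fin m) :=
  WithLp.toLp 2 fun i => n i * (2 * Real.pi)

@[simp]
theorem torusPeriod_apply (n : Fin m → ℤ) (i : Fin m) :
    torusPeriod n i = n i * (2 * Real.pi) := rfl

theorem torusPeriod_zero : torusPeriod (0 : Fin m → ℤ) = 0 := by
  ext i
  simp

theorem torusPeriod_add (n n' : Fin m → ℤ) :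
    torusPeriod (n + n') = torusPeriod n + torusPeriod n' := by
  ext i
  simp [add_mul]

theorem torusExp_eq_torusExp_iff {θ θ' : EuclideanSpace ℝ (Fin m)} :
    torusExp θ = torusExp θ' ↔ ∃ n, θ = θ' + torusPeriod n := by
  constructor
  · intro h
    choose n hn using fun i => Circle.exp_eq_exp.1 (congrFun h i)
    exact ⟨n, by ext i; simpa using hn i⟩
  · rintro ⟨n, rfl⟩
    ext1 i
    exact Circle.exp_eq_exp.2 ⟨n i, by simp⟩

theorem torusExp_surjective : Function.Surjective (torusExp (m := m)) := by
  intro t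
  choose θ hθ using fun i => Circle.exp_surjective (t i)
  exact ⟨WithLp.toLp 2 θ, funext hθ⟩

theorem isLocalHomeomorph_torusExp : IsLocalHomeomorph (torusExp (m := m)) := by
  have : IsLocalHomeomorph fun (θ : Fin m → ℝ) i => Circle.exp (θ i) := by
    refine IsLocalHomeomorph.mk _ fun θ => ?_
    choose e he using fun i => isLocalHomeomorph_circleExp (θ i)
    refine ⟨OpenPartialHomeomorph.pi e, fun i _ => (he i).1, fun x _ => ?_⟩
    ext1 i
    exact congrFun (he i).2 (x i)
  exact this.comp (PiLp.homeomorph 2 fun _ : Fin m => ℝ).isLocalHomeomorph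

theorem isQuotientMap_torusExp : IsQuotientMap (torusExp (m := m)) :=
  isLocalHomeomorph_torusExp.isOpenMap.isQuotientMap continuous_torusExp torusExp_surjective

theorem exists_continuous_comp_torusExp_eq {X : Type*} [TopologicalSpace X]
    {f : EuclideanSpace ℝ (Fin m) → X} (hf : Continuous f)
    (hper : ∀ τ n, f (τ + torusPeriod n) = f τ) :
    ∃ g : Torus m → X, Continuous g ∧ ∀ τ, g (torusExp τ) = f τ := by
  refine ⟨fun t => f (Function.surjInv torusExp_surjective t), ?_, ?_⟩
  swap
  · intro τ
    obtain ⟨n, hn⟩ := torusExp_eq_torusExp_iff.1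
      (Function.surjInv_eq torusExp_surjective (torusExp τ))
    dsimp only
    rw [hn, hper]
  · rw [isQuotientMap_torusExp.continuous_iff]
    convert hf using 1
    ext τ
    obtain ⟨n, hn⟩ := torusExp_eq_torusExp_iff.1
      (Function.surjInv_eq torusExp_surjective (torusExp τ))
    rw [Function.comp_apply, hn, hper]

/-- The endomorphism `t ↦ (∏ₗ tₗ ^ B₁ₗ, …, ∏ₗ tₗ ^ Bₘₗ)` of the torus. -/
def torusMonomial (B : Matrix (Fin m) (Fin m) ℤ) : Torus m →* Torus m where
  toFun t i := ∏ l, t l ^ B i l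
  map_one' := by
    ext1 i
    simp
  map_mul' s t := by
    ext1 i
    simp [mul_zpow, Finset.prod_mul_distrib]

/-- The linear map of `ℝᵐ` with an integral matrix. -/
def intMatrixMap (B : Matrix (Fin m) (Fin m) ℤ) (τ : EuclideanSpace ℝ (Fin m)) :
    EuclideanSpace ℝ (Fin m) :=
  WithLp.toLp 2 ((B.map (Int.cast : ℤ → ℝ)).mulVec τ)

theorem continuous_intMatrixMap (B : Matrix (Fin m) (Fin m) ℤ) :
    Continuous (intMatrixMap B) :=
  (PiLp.continuous_toLp 2 _).comp
    (Continuous.matrix_mulVec continuous_const (PiLp.continuous_ofLp 2 _))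

theorem torusExp_intMatrixMap (B : Matrix (Fin m) (Fin m) ℤ) (τ : EuclideanSpace ℝ (Fin m)) :
    torusExp (intMatrixMap B τ) = torusMonomial B (torusExp τ) := by
  ext i
  simp only [torusExp, intMatrixMap, torusMonomial, Matrix.mulVec, dotProduct, Circle.coe_exp,
    MonoidHom.coe_mk, OneHom.coe_mk]
  refine Eq.trans ?_ (map_prod Circle.coeHom _ _).symm
  push_cast
  rw [Finset.sum_mul, Complex.exp_sum]
  refine Finset.prod_congr rfl fun l _ => ?_
  rw [map_zpow]
  change _ = (Circle.exp (τ l) : ℂ) ^ B i l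
  rw [Circle.coe_exp, ← Complex.exp_int_mul]
  simp [mul_assoc]

theorem intMatrixMap_add_torusPeriod (B : Matrix (Fin m) (Fin m) ℤ)
    (τ : EuclideanSpace ℝ (Fin m)) (n : Fin m → ℤ) :
    intMatrixMap B (τ + torusPeriod n) = intMatrixMap B τ + torusPeriod (B.mulVec n) := by
  ext i
  simp only [intMatrixMap, Matrix.mulVec, dotProduct, PiLp.add_apply, torusPeriod_apply,
    Matrix.map_apply, mul_add, Finset.sum_add_distrib]
  push_cast
  rw [Finset.sum_mul]
  congr 1
  exact Finset.sum_congr rfl fun l _ => by ring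

theorem intMatrixMap_bijective {B : Matrix (Fin m) (Fin m) ℤ} (hB : B.det ≠ 0) :
    Function.Bijective (intMatrixMap B) := by
  have hdet : IsUnit (B.map (Int.cast : ℤ → ℝ)).det := by
    rw [isUnit_iff_ne_zero, show B.map (Int.cast : ℤ → ℝ) = (Int.castRingHom ℝ).mapMatrix B from rfl,
      ← RingHom.map_det]
    simpa using hB
  refine ⟨fun τ τ' h => ?_, fun θ => ⟨WithLp.toLp 2 ((B.map Int.cast)⁻¹.mulVec θ), ?_⟩⟩
  · have := Matrix.mulVec_injective_of_isUnit ((Matrix.isUnit_iff_isUnit_det _).2 hdet)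
      (WithLp.toLp_injective 2 h)
    exact WithLp.ofLp_injective 2 this
  · rw [intMatrixMap, Matrix.mulVec_mulVec, Matrix.mul_nonsing_inv _ hdet, Matrix.one_mulVec]

end TorusExp

/-- A subgroup of finite index is free of full rank; the columns of the matrix are a basis of it. -/
theorem AddSubgroup.exists_matrix_range_eq {m : ℕ} (L : AddSubgroup (Fin m → ℤ))
    [Finite ((Fin m → ℤ) ⧸ L)] :
    ∃ B : Matrix (Fin m) (Fin m) ℤ, B.det ≠ 0 ∧ ∀ n, n ∈ L ↔ ∃ c, B.mulVec c = n := by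
  set N : Submodule ℤ (Fin m → ℤ) := AddSubgroup.toIntSubmodule L
  have hfin : Finite ((Fin m → ℤ) ⧸ N) := ‹Finite ((Fin m → ℤ) ⧸ L)›
  have hrank : Module.finrank ℤ N = m := by
    rw [(Submodule.finiteQuotient_iff N).1 hfin, Module.finrank_fin_fun]
  let b : Module.Basis (Fin m) ℤ N := Module.finBasisOfFinrankEq ℤ N hrank
  have hmul : ∀ c, (Matrix.of fun i l => (b l : Fin m → ℤ) i).mulVec c =
      ((∑ l, c l • b l : N) : Fin m → ℤ) := by
    intro c
    ext i
    simp [Matrix.mulVec, dotProduct, mul_comm]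
  refine ⟨Matrix.of fun i l => (b l : Fin m → ℤ) i, fun h => ?_, fun n => ⟨fun hn => ?_, ?_⟩⟩
  · obtain ⟨c, hc, h0⟩ := Matrix.exists_mulVec_eq_zero_iff.2 h
    rw [hmul, ZeroMemClass.coe_eq_zero] at h0
    exact hc (funext (Fintype.linearIndependent_iff.1 b.linearIndependent c h0))
  · refine ⟨b.repr ⟨n, hn⟩, ?_⟩
    rw [hmul, b.sum_repr]
  · rintro ⟨c, rfl⟩
    rw [hmul]
    exact (∑ l, c l • b l : N).2

/-- The fibre is closed in a compact space and discrete. -/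
theorem IsCoveringMap.finite_fiber {X Y : Type*} [TopologicalSpace X] [TopologicalSpace Y]
    [CompactSpace X] [T1Space Y] {p : X → Y} (hp : IsCoveringMap p) (y : Y) :
    Finite (p ⁻¹' {y}) := by
  have hc : IsClosed (p ⁻¹' {y}) := isClosed_singleton.preimage hp.continuous
  have : CompactSpace (p ⁻¹' {y}) := isCompact_iff_compactSpace.1 hc.isCompact
  have := (hp y).discreteTopology_fiber
  exact finite_of_compact_of_discrete

section Lifts

variable {X : Type*} [TopologicalSpace X] {m : ℕ}

/-- The lifts of the universal covering `torusExp` through `p : X → Tᵐ`. -/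
def TorusLift (p : X → Torus m) : Type _ :=
  {σ : C(EuclideanSpace ℝ (Fin m), X) // ∀ τ, p (σ τ) = torusExp τ}

namespace TorusLift

variable {p : X → Torus m}

/-- Deck transformations act by precomposition. Orbits of lifts will correspond to the components of
`X`, and stabilizers to the period lattices of the components. -/
instance : AddAction (Fin m → ℤ) (TorusLift p) where
  vadd n σ := ⟨⟨fun τ => σ.1 (τ + torusPeriod n), by fun_prop⟩, fun τ => by
    rw [ContinuousMap.coe_mk, σ.2]
    exact torusExp_eq_torusExp_iff.2 ⟨n, rfl⟩⟩
  zero_vadd σ := Subtype.ext <| ContinuousMap.ext fun τ => by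
    change σ.1 (τ + torusPeriod 0) = σ.1 τ
    rw [torusPeriod_zero, add_zero]
  add_vadd n n' σ := Subtype.ext <| ContinuousMap.ext fun τ => by
    change σ.1 (τ + torusPeriod (n + n')) = σ.1 (τ + torusPeriod n + torusPeriod n')
    rw [torusPeriod_add, add_assoc]

theorem vadd_apply (n : Fin m → ℤ) (σ : TorusLift p) (τ : EuclideanSpace ℝ (Fin m)) :
    (n +ᵥ σ).1 τ = σ.1 (τ + torusPeriod n) := rfl

theorem eq_of_apply_eq (hp : IsCoveringMap p) {σ σ' : TorusLift p}
    {τ : EuclideanSpace ℝ (Fin m)} (h : σ.1 τ = σ'.1 τ) : σ = σ' := by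
  obtain ⟨F, -, hF⟩ := hp.existsUnique_continuousMap_lifts ⟨torusExp, continuous_torusExp⟩ τ
    (σ.1 τ) (σ.2 τ)
  exact Subtype.ext ((hF _ ⟨rfl, funext σ.2⟩).trans (hF _ ⟨h.symm, funext σ'.2⟩).symm)

theorem exists_apply_eq (hp : IsCoveringMap p) {x : X} {τ : EuclideanSpace ℝ (Fin m)}
    (h : p x = torusExp τ) : ∃ σ : TorusLift p, σ.1 τ = x := by
  obtain ⟨F, hF, -⟩ := hp.existsUnique_continuousMap_lifts ⟨torusExp, continuous_torusExp⟩ τ x h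
  exact ⟨⟨F, congrFun hF.2⟩, hF.1⟩

/-- A lift is determined by its value at 0, which lies in a finite fibre. -/
theorem finite [CompactSpace X] (hp : IsCoveringMap p) : Finite (TorusLift p) := by
  have := hp.finite_fiber (torusExp 0)
  exact Finite.of_injective
    (fun σ : TorusLift p => (⟨σ.1 0, σ.2 0⟩ : p ⁻¹' {torusExp 0}))
    fun σ σ' h => eq_of_apply_eq hp (congrArg Subtype.val h)

end TorusLift

/-- A compact covering space of a torus is a finite disjoint union of tori, each of which is
mapped to the base by a surjective monomial map. -/
theorem exists_homeomorph_sigma_torus [CompactSpace X] [T2Space X] {p : X → Torus m}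
    (hp : IsCoveringMap p) :
    ∃ (s : ℕ) (B : Fin s → Matrix (Fin m) (Fin m) ℤ) (h : (Σ _ : Fin s, Torus m) ≃ₜ X),
      ∀ j, (∀ t, p (h ⟨j, t⟩) = torusMonomial (B j) t) ∧
        Function.Surjective (torusMonomial (B j)) := by
  have := TorusLift.finite hp
  set O := AddAction.orbitRel.Quotient (Fin m → ℤ) (TorusLift p)
  have : Finite O := Quotient.finite _
  obtain ⟨s, ⟨e⟩⟩ := Finite.exists_equiv_fin O
  -- One lift is chosen from each orbit. Orbits are finite, so the stabilizers have finite index.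
  let σ : Fin s → TorusLift p := fun j => (e.symm j).out
  have hfin : ∀ j, Finite ((Fin m → ℤ) ⧸ AddAction.stabilizer (Fin m → ℤ) (σ j)) := fun j =>
    Finite.of_equiv _ (AddAction.orbitEquivQuotientStabilizer (Fin m → ℤ) (σ j))
  choose B hB0 hB using fun j => (AddAction.stabilizer (Fin m → ℤ) (σ j)).exists_matrix_range_eq
  -- Precomposing with the matrix of the stabilizer turns its periods into the standard ones, so the
  -- lift descends to the torus.
  choose f hfc hf using fun j => exists_continuous_comp_torusExp_eq
    (f := fun τ => (σ j).1 (intMatrixMap (B j) τ))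
    ((σ j).1.continuous.comp (continuous_intMatrixMap _)) (fun τ n => by
      have : (B j).mulVec n ∈ AddAction.stabilizer (Fin m → ℤ) (σ j) := (hB j _).2 ⟨n, rfl⟩
      rw [intMatrixMap_add_torusPeriod, ← TorusLift.vadd_apply, AddAction.mem_stabilizer_iff.1 this])
  have hpf : ∀ j t, p (f j t) = torusMonomial (B j) t := by
    intro j t
    obtain ⟨τ, rfl⟩ := torusExp_surjective t
    rw [hf, (σ j).2, torusExp_intMatrixMap]
  have hbij : Function.Bijective fun q : Σ _ : Fin s, Torus m => f q.1 q.2 := by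
    constructor
    -- Equal values make some translate of `σ j` agree with `σ j'` at a point, hence everywhere. The
    -- orbits coincide, and the translation lies in the stabilizer, i.e. is a period of the
    -- reparametrized lift.
    · rintro ⟨j, t⟩ ⟨j', t'⟩ h
      obtain ⟨τ, rfl⟩ := torusExp_surjective t
      obtain ⟨τ', rfl⟩ := torusExp_surjective t'
      dsimp only at h
      rw [hf, hf] at h
      obtain ⟨n, hn⟩ := torusExp_eq_torusExp_iff.1
        (((σ j).2 _).symm.trans ((congrArg p h).trans ((σ j').2 _)))
      have hσ : n +ᵥ σ j = σ j' := by
        refine TorusLift.eq_of_apply_eq hp (τ := intMatrixMap (B j') τ') ?_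
        rw [TorusLift.vadd_apply, ← hn, h]
      obtain rfl : j = j' := by
        refine e.symm.injective ?_
        rw [← Quotient.out_eq (e.symm j), ← Quotient.out_eq (e.symm j')]
        refine (Quotient.sound ?_).symm
        exact AddAction.orbitRel_apply.2 ⟨n, hσ⟩
      obtain ⟨c, rfl⟩ := (hB j n).1 (AddAction.mem_stabilizer_iff.2 hσ)
      rw [← intMatrixMap_add_torusPeriod] at hn
      have := torusExp_eq_torusExp_iff.2 ⟨c, (intMatrixMap_bijective (hB0 j)).1 hn⟩
      rw [this]
    -- A lift through `x` is a translate of its orbit's representative; the translation is moved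
    -- into the argument.
    · intro x
      obtain ⟨θ, hθ⟩ := torusExp_surjective (p x)
      obtain ⟨ρ, hρ⟩ := TorusLift.exists_apply_eq hp hθ.symm
      obtain ⟨n, hn⟩ : ∃ n : Fin m → ℤ, n +ᵥ σ (e (Quotient.mk _ ρ)) = ρ := by
        have : Quotient.mk (AddAction.orbitRel (Fin m → ℤ) (TorusLift p)) ρ =
            Quotient.mk _ (σ (e (Quotient.mk _ ρ))) := by
          simp [σ]
        exact AddAction.orbitRel_apply.1 (Quotient.exact this)
      obtain ⟨τ, hτ⟩ := (intMatrixMap_bijective (hB0 (e (Quotient.mk _ ρ)))).2 (θ + torusPeriod n)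
      refine ⟨⟨e (Quotient.mk _ ρ), torusExp τ⟩, ?_⟩
      dsimp only
      rw [hf, hτ, ← TorusLift.vadd_apply, hn, hρ]
  refine ⟨s, B, Continuous.homeoOfEquivCompactToT2 (f := Equiv.ofBijective _ hbij)
    (continuous_sigma fun j => hfc j), fun j => ⟨hpf j, fun t => ?_⟩⟩
  obtain ⟨θ, rfl⟩ := torusExp_surjective t
  obtain ⟨τ, rfl⟩ := (intMatrixMap_bijective (hB0 j)).2 θ
  exact ⟨torusExp τ, (torusExp_intMatrixMap _ _).symm⟩

end Lifts

end

/-! ### Smooth maps into tori and the smooth structure pulled back from a torus. -/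

noncomputable section

open scoped Topology
open Filter Topology

section TorusModel

variable {m : ℕ} {n : ℕ∞ω}

theorem contMDiff_torus {E H M : Type*} [NormedAddCommGroup E] [NormedSpace ℝ E]
    [TopologicalSpace H] {I : ModelWithCorners ℝ E H} [TopologicalSpace M] [ChartedSpace H M]
    {f : M → Torus m} (hf : ∀ i, ContMDiff I (𝓡 1) n fun x => f x i) :
    ContMDiff I (torusModel m) n f := by
  intro x
  have h i := contMDiffAt_iff.1 (hf i x)
  refine contMDiffAt_iff.2 ⟨continuousAt_pi.2 fun i => (h i).1, ?_⟩
  exact contDiffWithinAt_pi.2 fun i => (h i).2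

theorem contMDiff_torus_apply (i : Fin m) :
    ContMDiff (torusModel m) (𝓡 1) n fun t : Torus m => t i := by
  intro t
  refine contMDiffAt_iff.2 ⟨(continuous_apply i).continuousAt, ?_⟩
  have hev : (extChartAt (𝓡 1) (t i) ∘ (fun t : Torus m => t i) ∘
      (extChartAt (torusModel m) t).symm) =ᶠ[𝓝 (extChartAt (torusModel m) t t)] fun x => x i := by
    have h1 : ∀ᶠ y in 𝓝 (extChartAt (𝓡 1) (t i) (t i)), extChartAt (𝓡 1) (t i)
        ((extChartAt (𝓡 1) (t i)).symm y) = y := by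
      filter_upwards [extChartAt_target_mem_nhds (I := 𝓡 1) (t i)] with y hy
      exact (extChartAt (𝓡 1) (t i)).right_inv hy
    have h2 : ContinuousAt (fun y : Fin m → EuclideanSpace ℝ (Fin 1) => y i)
        (extChartAt (torusModel m) t t) := (continuous_apply i).continuousAt
    exact h2.eventually h1
  exact ((contDiff_apply ℝ _ i).contDiffAt.congr_of_eventuallyEq hev).contDiffWithinAt

theorem contMDiff_circle_coe : ContMDiff (𝓡 1) 𝓘(ℝ, ℂ) n (fun z : Circle => (z : ℂ)) :=
  have : Fact (Module.finrank ℝ ℂ = 1 + 1) := finrank_real_complex_fact'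
  contMDiff_coe_sphere

theorem contMDiff_torusIncl :
    ContMDiff (torusModel m) 𝓘(ℝ, Fin m → ℂ) n (torusIncl (m := m)) :=
  contMDiff_pi_space.2 fun i => contMDiff_circle_coe.comp (contMDiff_torus_apply i)

theorem ContMDiff.circle_zpow {E H M : Type*} [NormedAddCommGroup E] [NormedSpace ℝ E]
    [TopologicalSpace H] {I : ModelWithCorners ℝ E H} [TopologicalSpace M] [ChartedSpace H M]
    {f : M → Circle} (hf : ContMDiff I (𝓡 1) n f) (a : ℤ) :
    ContMDiff I (𝓡 1) n fun x => f x ^ a := by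
  have : LieGroup (𝓡 1) n Circle := LieGroup.of_le (m := n) (n := ω) le_top
  have hpow : ∀ b : ℕ, ContMDiff I (𝓡 1) n fun x => f x ^ b := fun b =>
    (contMDiff_pow b).comp hf
  cases a with
  | ofNat b => simpa using hpow b
  | negSucc b => simpa [zpow_negSucc] using (hpow (b + 1)).inv

theorem contMDiff_torusMonomial (B : Matrix (Fin m) (Fin m) ℤ) :
    ContMDiff (torusModel m) (torusModel m) n (torusMonomial B) := by
  have : LieGroup (𝓡 1) n Circle := LieGroup.of_le (m := n) (n := ω) le_top
  refine contMDiff_torus fun i => ?_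
  change ContMDiff (torusModel m) (𝓡 1) n fun t : Torus m => ∏ l, t l ^ B i l
  exact contMDiff_finsetProd (I := 𝓡 1) (n := n) fun l _ => (contMDiff_torus_apply l).circle_zpow _

end TorusModel

/-- Local uniqueness of lifts: `q` is injective near the common value. -/
theorem IsLocalHomeomorph.eventuallyEq_of_comp {A Y Z : Type*} [TopologicalSpace A]
    [TopologicalSpace Y] [TopologicalSpace Z] {q : Y → Z} (hq : IsLocalHomeomorph q)
    {f g : A → Y} {a : A} (hf : ContinuousAt f a) (hg : ContinuousAt g a) (h : f a = g a)
    (hfg : ∀ᶠ b in 𝓝 a, q (f b) = q (g b)) : f =ᶠ[𝓝 a] g := by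
  obtain ⟨e, he, rfl⟩ := hq (f a)
  filter_upwards [hfg, hf (e.open_source.mem_nhds he), hg (e.open_source.mem_nhds (h ▸ he))]
    with b hb h1 h2 using e.injOn h1 h2 hb

section TorusChart

variable {X : Type*} [TopologicalSpace X] {m : ℕ} {p : X → Torus m}

/-- The chart at `x` of a space over the torus: the angles of the base point. -/
def torusChart (hp : IsLocalHomeomorph p) (x : X) :
    OpenPartialHomeomorph X (EuclideanSpace ℝ (Fin m)) :=
  (hp.localInverseAt x).symm ≫ₕ
    isLocalHomeomorph_torusExp.localInverseAt (Function.surjInv torusExp_surjective (p x))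

theorem mem_torusChart_source (hp : IsLocalHomeomorph p) (x : X) :
    x ∈ (torusChart hp x).source := by
  rw [torusChart, OpenPartialHomeomorph.trans_source]
  refine ⟨by simp, ?_⟩
  have := isLocalHomeomorph_torusExp.apply_self_mem_localInverseAt_source
    (x := Function.surjInv torusExp_surjective (p x))
  rw [Function.surjInv_eq torusExp_surjective] at this
  simpa using this

theorem torusExp_torusChart (hp : IsLocalHomeomorph p) (x : X) {y : X}
    (hy : y ∈ (torusChart hp x).source) : torusExp (torusChart hp x y) = p y := by
  rw [torusChart, OpenPartialHomeomorph.trans_source] at hy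
  have := hy.2
  simp only [IsLocalHomeomorph.localInverseAt_symm, Set.mem_preimage] at this
  simp [torusChart, isLocalHomeomorph_torusExp.apply_localInverseAt_of_mem this]

/-- The charted space structure pulled back from the torus by a local homeomorphism. -/
abbrev torusChartedSpace (hp : IsLocalHomeomorph p) :
    ChartedSpace (EuclideanSpace ℝ (Fin m)) X where
  atlas := Set.range (torusChart hp)
  chartAt := torusChart hp
  mem_chart_source := mem_torusChart_source hp
  chart_mem_atlas := Set.mem_range_self

theorem isManifold_torusChartedSpace (hp : IsLocalHomeomorph p) :
    @IsManifold ℝ _ _ _ _ _ _ (𝓡 m) ∞ X _ (torusChartedSpace hp) := by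
  let := torusChartedSpace hp
  refine isManifold_of_contDiffOn (𝓡 m) ∞ X ?_
  rintro _ _ ⟨x, rfl⟩ ⟨y, rfl⟩
  intro v hv
  have hv' : v ∈ ((torusChart hp x).symm ≫ₕ torusChart hp y).source := by simpa using hv
  set φ := (torusChart hp x).symm ≫ₕ torusChart hp y with hφ
  -- A transition map preserves `torusExp`, so it is locally the translation by the period `φ v -
  -- v`.
  have hev : φ =ᶠ[𝓝 v] fun w => w + (φ v - v) := by
    refine isLocalHomeomorph_torusExp.eventuallyEq_of_comp (φ.continuousAt hv')
      (by fun_prop) (by abel) ?_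
    have key : ∀ w ∈ φ.source, torusExp (φ w) = torusExp w := by
      intro w hw
      rw [hφ, OpenPartialHomeomorph.trans_source] at hw
      rw [hφ, OpenPartialHomeomorph.trans_apply, torusExp_torusChart hp y hw.2,
        ← torusExp_torusChart hp x ((torusChart hp x).map_target hw.1),
        (torusChart hp x).right_inv hw.1]
    obtain ⟨n, hn⟩ := torusExp_eq_torusExp_iff.1 (key v hv')
    filter_upwards [φ.open_source.mem_nhds hv'] with w hw
    rw [key w hw, hn, add_sub_cancel_left]
    exact (torusExp_eq_torusExp_iff.2 ⟨n, rfl⟩).symm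
  have : ContDiffAt ℝ ∞ φ v :=
    ContDiffAt.congr_of_eventuallyEq (by fun_prop) hev
  exact this.contDiffWithinAt

end TorusChart

section Charts

variable {m : ℕ} {M F : Type*} [TopologicalSpace M]
  [ChartedSpace (EuclideanSpace ℝ (Fin m)) M] [NormedAddCommGroup F] [NormedSpace ℝ F]
  {n : ℕ∞ω} {f : M → F} {x : M}

theorem contMDiffAt_of_contDiffAt_chartAt_symm
    (hf : ContDiffAt ℝ n (f ∘ (chartAt (EuclideanSpace ℝ (Fin m)) x).symm)
      (chartAt (EuclideanSpace ℝ (Fin m)) x x)) :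
    ContMDiffAt (𝓡 m) 𝓘(ℝ, F) n f x := by
  refine contMDiffAt_iff.2 ⟨?_, hf.contDiffWithinAt⟩
  have := hf.continuousAt.comp
    ((chartAt (EuclideanSpace ℝ (Fin m)) x).continuousAt (mem_chart_source _ x))
  refine this.congr ?_
  filter_upwards [(chartAt (EuclideanSpace ℝ (Fin m)) x).open_source.mem_nhds
    (mem_chart_source _ x)] with y hy
  simp [(chartAt (EuclideanSpace ℝ (Fin m)) x).left_inv hy]

theorem mfderiv_eq_fderiv_chartAt_symm (hf : MDifferentiableAt (𝓡 m) 𝓘(ℝ, F) f x) :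
    mfderiv (𝓡 m) 𝓘(ℝ, F) f x = fderiv ℝ (f ∘ (chartAt (EuclideanSpace ℝ (Fin m)) x).symm)
      (chartAt (EuclideanSpace ℝ (Fin m)) x x) := by
  rw [hf.mfderiv]
  simp [writtenInExtChartAt]
  rfl

end Charts

end

/-! ### Gauss–Kronecker curvature of a local graph. -/

noncomputable section

open scoped Topology
open Filter Topology

theorem inner_snocEquiv {d : ℕ} (p q : EuclideanSpace ℝ (Fin d) × ℝ) :
    inner ℝ (snocEquiv d p) (snocEquiv d q) = inner ℝ p.1 q.1 + p.2 * q.2 := by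
  simp only [PiLp.inner_apply, Fin.sum_univ_castSucc, snocEquiv_castSucc, snocEquiv_last]
  simp [mul_comm]

theorem LinearMap.det_eq_zero_iff_exists {V : Type*} [AddCommGroup V] [Module ℝ V]
    [FiniteDimensional ℝ V] (f : V →ₗ[ℝ] V) : LinearMap.det f = 0 ↔ ∃ v ≠ 0, f v = 0 := by
  rw [← not_iff_not, ← Ne, ← isUnit_iff_ne_zero, ← LinearMap.isUnit_iff_isUnit_det,
    LinearMap.isUnit_iff_ker_eq_bot, LinearMap.ker_eq_bot']
  push Not
  exact forall_congr' fun v => not_imp_not.symm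

/-- The derivative of the parametrization of a graph in `ℝ^{d+1}`. -/
theorem hasFDerivAt_snocEquiv_graph {d : ℕ} {g : EuclideanSpace ℝ (Fin d) → ℝ}
    {g' : EuclideanSpace ℝ (Fin d) →L[ℝ] ℝ} {x : EuclideanSpace ℝ (Fin d)}
    (hg : HasFDerivAt g g' x) : HasFDerivAt (fun x => snocEquiv d (x, g x))
      ((snocEquiv d : _ →L[ℝ] _) ∘L (ContinuousLinearMap.id ℝ _).prod g') x :=
  (snocEquiv d).hasFDerivAt.comp x ((hasFDerivAt_id x).prodMk hg)

/-- The data of a local presentation of `S` as the graph of `g` over `x₀`, where `μ` is minus the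
gradient of `g`. -/
structure IsLocalGraph {d : ℕ} (S : Set (EuclideanSpace ℝ (Fin (d + 1))))
    (g : EuclideanSpace ℝ (Fin d) → ℝ) (μ : EuclideanSpace ℝ (Fin d) → EuclideanSpace ℝ (Fin d))
    (x₀ : EuclideanSpace ℝ (Fin d)) : Prop where
  mem : ∀ᶠ x in 𝓝 x₀, snocEquiv d (x, g x) ∈ S
  hasFDerivAt : ∀ᶠ x in 𝓝 x₀, HasFDerivAt g (-innerSL ℝ (μ x)) x
  eq_of_mem : ∀ᶠ q in 𝓝 (x₀, g x₀), snocEquiv d q ∈ S → g q.1 = q.2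

namespace IsLocalGraph

variable {d : ℕ} {S : Set (EuclideanSpace ℝ (Fin (d + 1)))} {g : EuclideanSpace ℝ (Fin d) → ℝ}
  {μ : EuclideanSpace ℝ (Fin d) → EuclideanSpace ℝ (Fin d)} {x₀ : EuclideanSpace ℝ (Fin d)}

theorem eventually_mem_tangentSpaceOf (h : IsLocalGraph S g μ x₀) :
    ∀ᶠ x in 𝓝 x₀, ∀ w, snocEquiv d (w, -inner ℝ (μ x) w) ∈
      tangentSpaceOf S (snocEquiv d (x, g x)) := by
  filter_upwards [h.mem.eventually_nhds, h.hasFDerivAt] with x hx hg w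
  refine Submodule.subset_span ?_
  have h1 := (hasFDerivAt_snocEquiv_graph hg).hasFDerivWithinAt
    (s := {x | snocEquiv d (x, g x) ∈ S})
  have hw : w ∈ tangentConeAt ℝ {x | snocEquiv d (x, g x) ∈ S} x := by
    rw [tangentConeAt_of_mem_nhds hx]
    trivial
  have h2 := h1.mapsTo_tangent_cone hw
  exact tangentConeAt_mono (Set.image_subset_iff.2 fun x hx => hx) h2

/-- One inclusion pushes tangent vectors forward along the graph. For the other, g(x) - y vanishes
on `S` near the point, so its differential kills the tangent cone and hence its span. -/
theorem mem_tangentSpaceOf_iff (h : IsLocalGraph S g μ x₀) (v : EuclideanSpace ℝ (Fin (d + 1))) :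
    v ∈ tangentSpaceOf S (snocEquiv d (x₀, g x₀)) ↔
      ∃ w, snocEquiv d (w, -inner ℝ (μ x₀) w) = v := by
  refine ⟨fun hv => ?_, fun ⟨w, hw⟩ => hw ▸ h.eventually_mem_tangentSpaceOf.self_of_nhds w⟩
  set F : EuclideanSpace ℝ (Fin (d + 1)) → ℝ := fun θ =>
    g ((snocEquiv d).symm θ).1 - ((snocEquiv d).symm θ).2 with hF
  set P := snocEquiv d (x₀, g x₀) with hP
  set F' : EuclideanSpace ℝ (Fin (d + 1)) →L[ℝ] ℝ :=
    ((-innerSL ℝ (μ x₀)) ∘L .fst ℝ _ _ - .snd ℝ _ _) ∘L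
      ((snocEquiv d).symm : _ →L[ℝ] EuclideanSpace ℝ (Fin d) × ℝ) with hF'
  have h1 : HasFDerivAt F F' P := by
    have hfst : HasFDerivAt (fun q : EuclideanSpace ℝ (Fin d) × ℝ => g q.1 - q.2)
        ((-innerSL ℝ (μ x₀)) ∘L .fst ℝ _ _ - .snd ℝ _ _) ((snocEquiv d).symm P) := by
      rw [hP, ContinuousLinearEquiv.symm_apply_apply]
      exact (h.hasFDerivAt.self_of_nhds.comp (x₀, g x₀) hasFDerivAt_fst).sub hasFDerivAt_snd
    exact hfst.comp P (snocEquiv d).symm.hasFDerivAt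
  have h2 : HasFDerivWithinAt F (0 : EuclideanSpace ℝ (Fin (d + 1)) →L[ℝ] ℝ) S P := by
    have hev : ∀ᶠ θ in 𝓝[S] P, F θ = 0 := by
      have hc : Tendsto (snocEquiv d).symm (𝓝 P) (𝓝 (x₀, g x₀)) := by
        have := (snocEquiv d).symm.continuous.tendsto P
        rwa [hP, ContinuousLinearEquiv.symm_apply_apply] at this
      filter_upwards [nhdsWithin_le_nhds (hc.eventually h.eq_of_mem), self_mem_nhdsWithin]
        with θ hθ hS
      rw [ContinuousLinearEquiv.apply_symm_apply] at hθ
      exact sub_eq_zero.2 (hθ hS)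
    exact (hasFDerivWithinAt_const (0 : ℝ) P S).congr_of_eventuallyEq hev (by simp [hF, hP])
  have hker : tangentSpaceOf S P ≤ F'.ker := Submodule.span_le.2 fun w hw =>
    h1.hasFDerivWithinAt.unique_on h2 hw
  have hv' : F' v = 0 := hker hv
  refine ⟨((snocEquiv d).symm v).1, ?_⟩
  rw [← ContinuousLinearEquiv.eq_symm_apply]
  refine Prod.ext rfl ?_
  simpa [hF', sub_eq_zero] using hv'

variable {N : EuclideanSpace ℝ (Fin (d + 1)) → EuclideanSpace ℝ (Fin (d + 1))}

/-- Orthogonality to all (w, -⟨μ, w⟩) leaves only the line of (μ, 1). -/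
theorem eventually_normal_eq (h : IsLocalGraph S g μ x₀) (hN : IsUnitNormalField S N) :
    ∀ᶠ x in 𝓝 x₀, N (snocEquiv d (x, g x)) =
      N (snocEquiv d (x, g x)) (Fin.last d) • snocEquiv d (μ x, 1) := by
  filter_upwards [h.mem, h.eventually_mem_tangentSpaceOf] with x hx hT
  set n := N (snocEquiv d (x, g x)) with hn
  have key : ((snocEquiv d).symm n).1 = n (Fin.last d) • μ x := by
    refine ext_inner_right ℝ fun w => ?_
    have := hN.normal _ hx _ (hT w)
    rw [← hn, ← (snocEquiv d).apply_symm_apply n, inner_snocEquiv] at this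
    rw [inner_smul_left]
    simp only [snocEquiv_symm_snd] at this
    simp only [conj_trivial]
    linarith
  apply (snocEquiv d).symm.injective
  rw [map_smul, ContinuousLinearEquiv.symm_apply_apply]
  exact Prod.ext key (by simp)

theorem normal_last_ne_zero (h : IsLocalGraph S g μ x₀) (hN : IsUnitNormalField S N) :
    N (snocEquiv d (x₀, g x₀)) (Fin.last d) ≠ 0 := by
  intro h0
  have h1 := (h.eventually_normal_eq hN).self_of_nhds
  have h2 := hN.norm_eq_one _ h.mem.self_of_nhds
  rw [h1, h0, zero_smul, norm_zero] at h2
  exact zero_ne_one h2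

/-- The product rule applied to N = N_last · (μ, 1) along the graph. The term with `c`, the
derivative of N_last, is normal to `S` and disappears under projection. -/
theorem exists_fderivWithin_normal_eq (h : IsLocalGraph S g μ x₀) (hN : IsUnitNormalField S N)
    (hμ : DifferentiableAt ℝ μ x₀) (w : EuclideanSpace ℝ (Fin d)) :
    ∃ c : ℝ, fderivWithin ℝ N S (snocEquiv d (x₀, g x₀)) (snocEquiv d (w, -inner ℝ (μ x₀) w)) =
      N (snocEquiv d (x₀, g x₀)) (Fin.last d) • snocEquiv d (fderiv ℝ μ x₀ w, 0) +
        c • snocEquiv d (μ x₀, 1) := by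
  have hd : DifferentiableWithinAt ℝ N S (snocEquiv d (x₀, g x₀)) :=
    (hN.smooth _ h.mem.self_of_nhds).differentiableWithinAt (by simp)
  have hΓ := hasFDerivAt_snocEquiv_graph h.hasFDerivAt.self_of_nhds
  have h1 : HasFDerivAt (fun x => N (snocEquiv d (x, g x)))
      (fderivWithin ℝ N S (snocEquiv d (x₀, g x₀)) ∘L
        ((snocEquiv d : _ →L[ℝ] _) ∘L (ContinuousLinearMap.id ℝ _).prod (-innerSL ℝ (μ x₀)))) x₀ :=
    hd.hasFDerivWithinAt.comp_hasFDerivAt x₀ hΓ h.mem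
  have h2 := (EuclideanSpace.proj (𝕜 := ℝ) (Fin.last d)).hasFDerivAt.comp x₀ h1
  have h3 : HasFDerivAt (fun x => snocEquiv d (μ x, (1 : ℝ)))
      ((snocEquiv d : _ →L[ℝ] _) ∘L (fderiv ℝ μ x₀).prod (0 : _ →L[ℝ] ℝ)) x₀ :=
    (snocEquiv d).hasFDerivAt.comp x₀ (hμ.hasFDerivAt.prodMk (hasFDerivAt_const (1 : ℝ) x₀))
  have h4 := (h2.smul h3).congr_of_eventuallyEq (h.eventually_normal_eq hN)
  have h5 := DFunLike.congr_fun (h1.unique h4) w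
  exact ⟨_, h5⟩

/-- Pairing dN with a tangent vector (u, -⟨μ, u⟩) gives N_last ⟨u, dμ(w)⟩ with N_last ≠ 0. So w ↦
(w, -⟨μ, w⟩) matches the kernels of dμ and of the Gauss differential. -/
theorem gaussKroneckerCurvature_eq_zero_iff (h : IsLocalGraph S g μ x₀)
    (hN : IsUnitNormalField S N) (hμ : DifferentiableAt ℝ μ x₀) :
    gaussKroneckerCurvature S N (snocEquiv d (x₀, g x₀)) = 0 ↔ (fderiv ℝ μ x₀).det = 0 := by
  set P := snocEquiv d (x₀, g x₀) with hP
  have key : ∀ w (hw : snocEquiv d (w, -inner ℝ (μ x₀) w) ∈ tangentSpaceOf S P),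
      gaussDifferential S N P ⟨_, hw⟩ = 0 ↔ fderiv ℝ μ x₀ w = 0 := by
    intro w hw
    obtain ⟨c, hc⟩ := h.exists_fderivWithin_normal_eq hN hμ w
    have : gaussDifferential S N P ⟨_, hw⟩ =
        (tangentSpaceOf S P).orthogonalProjectionOnto (fderivWithin ℝ N S P
          (snocEquiv d (w, -inner ℝ (μ x₀) w))) := rfl
    rw [this, hc, Submodule.orthogonalProjectionOnto_eq_zero_iff, Submodule.mem_orthogonal]
    have hpair : ∀ u, inner ℝ (snocEquiv d (u, -inner ℝ (μ x₀) u))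
        (N P (Fin.last d) • snocEquiv d (fderiv ℝ μ x₀ w, 0) + c • snocEquiv d (μ x₀, 1)) =
        N P (Fin.last d) * inner ℝ u (fderiv ℝ μ x₀ w) := by
      intro u
      rw [inner_add_right, inner_smul_right, inner_smul_right, inner_snocEquiv, inner_snocEquiv,
        real_inner_comm u (μ x₀)]
      ring
    constructor
    · intro hu
      have := hu _ (h.eventually_mem_tangentSpaceOf.self_of_nhds (fderiv ℝ μ x₀ w))
      rw [hpair, mul_eq_zero, or_iff_right (h.normal_last_ne_zero hN)] at this
      exact inner_self_eq_zero.1 this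
    · intro h0 v hv
      obtain ⟨u, rfl⟩ := (h.mem_tangentSpaceOf_iff v).1 hv
      rw [hpair, h0, inner_zero_right, mul_zero]
  rw [gaussKroneckerCurvature, ContinuousLinearMap.det, LinearMap.det_eq_zero_iff_exists,
    LinearMap.det_eq_zero_iff_exists]
  constructor
  · rintro ⟨⟨v, hv⟩, hne, h0⟩
    obtain ⟨w, rfl⟩ := (h.mem_tangentSpaceOf_iff v).1 hv
    refine ⟨w, ?_, (key w hv).1 h0⟩
    rintro rfl
    exact hne (Subtype.ext (by simp))
  · rintro ⟨w, hne, h0⟩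
    refine ⟨⟨_, h.eventually_mem_tangentSpaceOf.self_of_nhds w⟩, ?_, (key w _).2 h0⟩
    intro h
    have := congrArg (fun v => ((snocEquiv d).symm v.1).1) h
    simp at this
    exact hne this

end IsLocalGraph

end

/-! ### The projection π as a local homeomorphism, and its charts. -/

noncomputable section

open scoped Topology
open Filter Topology

namespace QuantumWalk

variable {d k : ℕ} {W : QuantumWalk d k}

theorem torusExp_snocEquiv_castSucc (q : EuclideanSpace ℝ (Fin d) × ℝ) (i : Fin d) :
    torusExp (snocEquiv d q) i.castSucc = torusExp q.1 i := by
  simp [torusExp]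

theorem isLocalHomeomorph_torusExp_snocEquiv :
    IsLocalHomeomorph fun q : EuclideanSpace ℝ (Fin d) × ℝ => torusExp (snocEquiv d q) :=
  isLocalHomeomorph_torusExp.comp (snocEquiv d).toHomeomorph.isLocalHomeomorph

theorem exists_torusExp_snocEquiv_eq (z : Torus (d + 1)) :
    ∃ q : EuclideanSpace ℝ (Fin d) × ℝ, torusExp (snocEquiv d q) = z := by
  obtain ⟨θ, rfl⟩ := torusExp_surjective z
  exact ⟨(snocEquiv d).symm θ, by rw [ContinuousLinearEquiv.apply_symm_apply]⟩

theorem SmoothnessHypothesis.exists_isLocalGraph (hW : W.SmoothnessHypothesis)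
    {p : EuclideanSpace ℝ (Fin d) × ℝ} (hp : snocEquiv d p ∈ W.logV₁) :
    ∃ g : EuclideanSpace ℝ (Fin d) → ℝ, ContDiffAt ℝ ∞ g p.1 ∧ g p.1 = p.2 ∧
      IsLocalGraph W.logV₁ g (fun x => W.slope (snocEquiv d (x, g x))) p.1 := by
  obtain ⟨g, hgs, hgp, h1, h2⟩ := hW.exists_local_graph hp
  refine ⟨g, hgs, hgp, h1.mono fun x hx => hx.1, h1.mono fun x hx => hx.2, ?_⟩
  rw [hgp]
  exact h2

theorem continuous_proj : Continuous W.proj :=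
  continuous_pi fun i => (continuous_apply i.castSucc).comp continuous_subtype_val

/-- The local graph is a continuous section of π through the given point. -/
theorem SmoothnessHypothesis.isOpenMap_proj (hW : W.SmoothnessHypothesis) :
    IsOpenMap W.proj := by
  rw [isOpenMap_iff_nhds_le]
  rintro ⟨z, hz⟩ S hS
  obtain ⟨p, rfl⟩ := exists_torusExp_snocEquiv_eq z
  obtain ⟨g, hgs, hgp, h⟩ := hW.exists_isLocalGraph hz
  rw [mem_map, nhds_subtype_eq_comap, mem_comap] at hS
  obtain ⟨T, hT, hTS⟩ := hS
  have hpz : W.proj ⟨torusExp (snocEquiv d p), hz⟩ = torusExp p.1 :=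
    funext fun i => torusExp_snocEquiv_castSucc p i
  rw [hpz, ← isLocalHomeomorph_torusExp.map_nhds_eq, mem_map]
  have hc : Tendsto (fun x => torusExp (snocEquiv d (x, g x))) (𝓝 p.1)
      (𝓝 (torusExp (snocEquiv d p))) := by
    have h1 : ContinuousAt (fun x => torusExp (snocEquiv d (x, g x))) p.1 :=
      (continuous_torusExp.comp (snocEquiv d).continuous).continuousAt.comp
        (continuousAt_id.prodMk hgs.continuousAt)
    have h2 := h1.tendsto
    rwa [hgp] at h2
  filter_upwards [hc.eventually hT, h.mem] with x hx hmem
  have h3 : W.proj ⟨torusExp (snocEquiv d (x, g x)), hmem⟩ ∈ S :=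
    hTS (show (⟨_, hmem⟩ : W.V₁) ∈ Subtype.val ⁻¹' T from hx)
  have h4 : W.proj ⟨torusExp (snocEquiv d (x, g x)), hmem⟩ = torusExp x :=
    funext fun i => torusExp_snocEquiv_castSucc (x, g x) i
  rwa [h4] at h3

/-- Local injectivity is what remains: near a point of 𝒱₁ the last angle is `g` of the others. -/
theorem SmoothnessHypothesis.isLocalHomeomorph_proj (hW : W.SmoothnessHypothesis) :
    IsLocalHomeomorph W.proj := by
  rw [isLocalHomeomorph_iff_isOpenEmbedding_restrict]
  rintro ⟨z, hz⟩
  obtain ⟨p, rfl⟩ := exists_torusExp_snocEquiv_eq z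
  obtain ⟨g, hgs, hgp, h⟩ := hW.exists_isLocalGraph hz
  set Λ := isLocalHomeomorph_torusExp_snocEquiv.localInverseAt p with hΛ
  set E := isLocalHomeomorph_torusExp.localInverseAt p.1 with hE
  have hΛp : Λ (torusExp (snocEquiv d p)) = p :=
    isLocalHomeomorph_torusExp_snocEquiv.localInverseAt_apply_self
  have hsrc : torusExp (snocEquiv d p) ∈ Λ.source :=
    isLocalHomeomorph_torusExp_snocEquiv.apply_self_mem_localInverseAt_source
  have hΛc : Tendsto Λ (𝓝 (torusExp (snocEquiv d p))) (𝓝 p) := by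
    have := (Λ.continuousAt hsrc).tendsto
    rwa [hΛp] at this
  have hEt : ∀ᶠ q in 𝓝 p, q.1 ∈ E.target :=
    continuous_fst.continuousAt.eventually
      (E.open_target.mem_nhds isLocalHomeomorph_torusExp.self_mem_localInverseAt_target)
  have heq : ∀ᶠ q in 𝓝 p, snocEquiv d q ∈ W.logV₁ → g q.1 = q.2 := by
    have := h.eq_of_mem
    rwa [hgp] at this
  have hev : ∀ᶠ w : W.V₁ in 𝓝 ⟨torusExp (snocEquiv d p), hz⟩, w.1 ∈ Λ.source ∧
      (snocEquiv d (Λ w.1) ∈ W.logV₁ → g (Λ w.1).1 = (Λ w.1).2) ∧ (Λ w.1).1 ∈ E.target :=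
    (continuous_subtype_val.tendsto (⟨torusExp (snocEquiv d p), hz⟩ : W.V₁)).eventually
      ((Λ.open_source.eventually_mem hsrc).and (hΛc.eventually (heq.and hEt)))
  obtain ⟨U, hU, hUo, hzU⟩ := eventually_nhds_iff.1 hev
  refine ⟨U, hUo.mem_nhds hzU, .of_continuous_injective_isOpenMap
    (continuous_proj.comp continuous_subtype_val) ?_ (hW.isOpenMap_proj.domRestrict hUo)⟩
  rintro ⟨w, hw⟩ ⟨w', hw'⟩ hww
  have hinv : ∀ w ∈ U, torusExp (snocEquiv d (Λ w.1)) = w := fun w hw =>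
    isLocalHomeomorph_torusExp_snocEquiv.apply_localInverseAt_of_mem (hU w hw).1
  have hproj : ∀ w ∈ U, torusExp (Λ w.1).1 = W.proj w := by
    intro w hw
    ext1 i
    rw [← torusExp_snocEquiv_castSucc, hinv w hw, proj]
  have hgr : ∀ w ∈ U, g (Λ w.1).1 = (Λ w.1).2 := fun w hw => (hU w hw).2.1 (by
    change torusExp _ ∈ W.V₁
    rw [hinv w hw]
    exact w.2)
  have hfst : (Λ w.1).1 = (Λ w'.1).1 := by
    refine isLocalHomeomorph_torusExp.injOn_localInverseAt_target (hU w hw).2.2 (hU w' hw').2.2 ?_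
    rw [hproj w hw, hproj w' hw']
    exact hww
  have : Λ w.1 = Λ w'.1 := Prod.ext hfst (by rw [← hgr w hw, ← hgr w' hw', hfst])
  exact Subtype.ext (Subtype.ext (by rw [← hinv w hw, ← hinv w' hw', this]))

/-- In the chart at `z`, the manifold `𝒱₁` is parametrized by the local graph of `-i log 𝒱₁`. -/
theorem eventually_torusChart_symm_eq (hp : IsLocalHomeomorph W.proj) {z : W.V₁}
    {p : EuclideanSpace ℝ (Fin d) × ℝ} (hz : torusExp (snocEquiv d p) = z)
    {g : EuclideanSpace ℝ (Fin d) → ℝ}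
    {μ : EuclideanSpace ℝ (Fin d) → EuclideanSpace ℝ (Fin d)} (hgp : g p.1 = p.2)
    (h : IsLocalGraph W.logV₁ g μ p.1) :
    ∀ᶠ x in 𝓝 (torusChart hp z z), (((torusChart hp z).symm x : W.V₁) : Torus (d + 1)) =
      torusExp (snocEquiv d (x + (p.1 - torusChart hp z z),
        g (x + (p.1 - torusChart hp z z)))) := by
  set e := torusChart hp z with he
  have hze : z ∈ e.source := mem_torusChart_source hp z
  set Λ := isLocalHomeomorph_torusExp_snocEquiv.localInverseAt p with hΛ
  have hΛp : Λ z = p := by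
    rw [← hz]
    exact isLocalHomeomorph_torusExp_snocEquiv.localInverseAt_apply_self
  have hsrc : (z : Torus (d + 1)) ∈ Λ.source := by
    rw [← hz]
    exact isLocalHomeomorph_torusExp_snocEquiv.apply_self_mem_localInverseAt_source
  have hyc : Tendsto (fun x => (e.symm x : Torus (d + 1))) (𝓝 (e z)) (𝓝 z) := by
    have := continuous_subtype_val.continuousAt.comp (e.symm.continuousAt (e.map_source hze))
    have := this.tendsto
    simpa [Function.comp_def, e.left_inv hze] using this
  have hΛc : Tendsto (fun x => Λ (e.symm x)) (𝓝 (e z)) (𝓝 p) := by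
    have := (Λ.continuousAt hsrc).tendsto
    rw [hΛp] at this
    exact this.comp hyc
  have heq : ∀ᶠ q in 𝓝 p, snocEquiv d q ∈ W.logV₁ → g q.1 = q.2 := by
    have := h.eq_of_mem
    rwa [hgp] at this
  have hinv : ∀ᶠ x in 𝓝 (e z), torusExp (snocEquiv d (Λ (e.symm x))) = e.symm x := by
    filter_upwards [hyc.eventually (Λ.open_source.mem_nhds hsrc)] with x hx
    exact isLocalHomeomorph_torusExp_snocEquiv.apply_localInverseAt_of_mem hx
  have htgt : ∀ᶠ x in 𝓝 (e z), x ∈ e.target := e.open_target.mem_nhds (e.map_source hze)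
  have hproj : ∀ x ∈ e.target, torusExp (snocEquiv d (Λ (e.symm x))) = e.symm x →
      torusExp (Λ (e.symm x)).1 = torusExp x := by
    intro x hx hxi
    conv_rhs => rw [← e.right_inv hx]
    rw [torusExp_torusChart hp z (e.map_target hx)]
    ext1 i
    rw [← torusExp_snocEquiv_castSucc, hxi, proj]
  -- The angles chosen by the chart and those of `p` differ by a constant period, whence the
  -- translation.
  have hfst : (fun x => (Λ (e.symm x)).1) =ᶠ[𝓝 (e z)] fun x => x + (p.1 - e z) := by
    refine isLocalHomeomorph_torusExp.eventuallyEq_of_comp ?_ (by fun_prop) ?_ ?_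
    · have := (continuous_fst.tendsto p).comp hΛc
      simpa [Function.comp_def, ContinuousAt, e.left_inv hze, hΛp] using this
    · simp [e.left_inv hze, hΛp]
    · have h0 := hproj _ htgt.self_of_nhds hinv.self_of_nhds
      rw [e.left_inv hze, hΛp] at h0
      obtain ⟨n, hn⟩ := torusExp_eq_torusExp_iff.1 h0
      filter_upwards [hinv, htgt] with x hx hxt
      rw [hproj x hxt hx, hn, add_sub_cancel_left]
      exact (torusExp_eq_torusExp_iff.2 ⟨n, rfl⟩).symm
  filter_upwards [hfst, hinv, hΛc.eventually heq] with x hx hxi hxe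
  have hmem : snocEquiv d (Λ (e.symm x)) ∈ W.logV₁ := by
    change torusExp _ ∈ W.V₁
    rw [hxi]
    exact (e.symm x).2
  rw [← hxi, ← hx, hxe hmem]

end QuantumWalk

end

/-! ### The Gauss map in charts, the normal field, immersions and the torus decomposition. -/

noncomputable section

open scoped Topology
open Filter Topology

namespace QuantumWalk

variable {d k : ℕ} {W : QuantumWalk d k}

theorem gaussMap_eq_slope {z : W.V₁} {θ : EuclideanSpace ℝ (Fin (d + 1))}
    (h : torusExp θ = z) : W.gaussMap z = W.slope θ := by
  rw [gaussMap, slope, h]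

/-- A local graph over `p`, together with the resulting parametrization of the chart at `z`. -/
theorem SmoothnessHypothesis.exists_isLocalGraph_chart (hW : W.SmoothnessHypothesis)
    (hp : IsLocalHomeomorph W.proj) {z : W.V₁} {p : EuclideanSpace ℝ (Fin d) × ℝ}
    (hz : torusExp (snocEquiv d p) = z) :
    ∃ g : EuclideanSpace ℝ (Fin d) → ℝ, ContDiffAt ℝ ∞ g p.1 ∧ g p.1 = p.2 ∧
      ContDiffAt ℝ ∞ (fun x => W.slope (snocEquiv d (x, g x))) p.1 ∧
      IsLocalGraph W.logV₁ g (fun x => W.slope (snocEquiv d (x, g x))) p.1 ∧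
      ∀ᶠ x in 𝓝 (torusChart hp z z), (((torusChart hp z).symm x : W.V₁) : Torus (d + 1)) =
        torusExp (snocEquiv d (x + (p.1 - torusChart hp z z),
          g (x + (p.1 - torusChart hp z z)))) := by
  have hmem : snocEquiv d p ∈ W.logV₁ := by
    change torusExp _ ∈ W.V₁
    rw [hz]
    exact z.2
  obtain ⟨g, hgs, hgp, h⟩ := hW.exists_isLocalGraph hmem
  refine ⟨g, hgs, hgp, ?_, h, eventually_torusChart_symm_eq hp hz hgp h⟩
  refine ContDiffAt.comp (g := W.slope) p.1 ?_
    ((snocEquiv d).contDiff.contDiffAt.comp p.1 (contDiffAt_id.prodMk hgs))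
  simp only [hgp]
  exact hW.contDiffAt_slope hmem

theorem contDiffAt_add_sub {F : Type*} [NormedAddCommGroup F] [NormedSpace ℝ F]
    {f : EuclideanSpace ℝ (Fin d) → F} {a b : EuclideanSpace ℝ (Fin d)}
    (hf : ContDiffAt ℝ ∞ f b) : ContDiffAt ℝ ∞ (fun x => f (x + (b - a))) a := by
  refine ContDiffAt.comp (g := f) a ?_ (by fun_prop)
  rwa [add_sub_cancel]

theorem SmoothnessHypothesis.contDiffAt_torusIncl_chart (hW : W.SmoothnessHypothesis)
    (hp : IsLocalHomeomorph W.proj) (z : W.V₁) :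
    ContDiffAt ℝ ∞ ((fun z : W.V₁ => torusIncl (z : Torus (d + 1))) ∘ (torusChart hp z).symm)
      (torusChart hp z z) := by
  obtain ⟨p, hz⟩ := exists_torusExp_snocEquiv_eq (z : Torus (d + 1))
  obtain ⟨g, hgs, -, -, -, h⟩ := hW.exists_isLocalGraph_chart hp hz
  have h1 : ContDiffAt ℝ ∞ (fun x => torusIncl (torusExp (snocEquiv d (x, g x)))) p.1 :=
    contDiff_torusIncl_torusExp.contDiffAt.comp p.1
      ((snocEquiv d).contDiff.contDiffAt.comp p.1 (contDiffAt_id.prodMk hgs))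
  refine (contDiffAt_add_sub (a := torusChart hp z z) h1).congr_of_eventuallyEq ?_
  filter_upwards [h] with x hx
  rw [Function.comp_apply, hx]

/-- In the chart at `z`, the logarithmic Gauss map is a translate of the slope of the graph. -/
theorem SmoothnessHypothesis.gaussMap_chart (hW : W.SmoothnessHypothesis)
    (hp : IsLocalHomeomorph W.proj) {z : W.V₁} {p : EuclideanSpace ℝ (Fin d) × ℝ}
    (hz : torusExp (snocEquiv d p) = z) :
    ∃ g : EuclideanSpace ℝ (Fin d) → ℝ, g p.1 = p.2 ∧
      ContDiffAt ℝ ∞ (fun x => W.slope (snocEquiv d (x, g x))) p.1 ∧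
      IsLocalGraph W.logV₁ g (fun x => W.slope (snocEquiv d (x, g x))) p.1 ∧
      (W.gaussMap ∘ (torusChart hp z).symm) =ᶠ[𝓝 (torusChart hp z z)]
        fun x => W.slope (snocEquiv d (x + (p.1 - torusChart hp z z),
          g (x + (p.1 - torusChart hp z z)))) := by
  obtain ⟨g, -, hgp, hs, hl, h⟩ := hW.exists_isLocalGraph_chart hp hz
  exact ⟨g, hgp, hs, hl, h.mono fun x hx => gaussMap_eq_slope hx.symm⟩

theorem SmoothnessHypothesis.contDiffAt_gaussMap_chart (hW : W.SmoothnessHypothesis)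
    (hp : IsLocalHomeomorph W.proj) (z : W.V₁) :
    ContDiffAt ℝ ∞ (W.gaussMap ∘ (torusChart hp z).symm) (torusChart hp z z) := by
  obtain ⟨p, hz⟩ := exists_torusExp_snocEquiv_eq (z : Torus (d + 1))
  obtain ⟨g, -, hs, -, h⟩ := hW.gaussMap_chart hp hz
  exact (contDiffAt_add_sub (a := torusChart hp z z) hs).congr_of_eventuallyEq h

theorem SmoothnessHypothesis.gaussKroneckerCurvature_eq_zero_iff (hW : W.SmoothnessHypothesis)
    (hp : IsLocalHomeomorph W.proj)
    {N : EuclideanSpace ℝ (Fin (d + 1)) → EuclideanSpace ℝ (Fin (d + 1))}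
    (hN : IsUnitNormalField W.logV₁ N) {z : W.V₁} {θ : EuclideanSpace ℝ (Fin (d + 1))}
    (hz : torusExp θ = z) :
    gaussKroneckerCurvature W.logV₁ N θ = 0 ↔
      (fderiv ℝ (W.gaussMap ∘ (torusChart hp z).symm) (torusChart hp z z)).det = 0 := by
  obtain ⟨p, rfl⟩ := (snocEquiv d).surjective θ
  obtain ⟨g, hgp, hs, hl, h⟩ := hW.gaussMap_chart hp hz
  have := hl.gaussKroneckerCurvature_eq_zero_iff hN (hs.differentiableAt (by simp))
  rw [h.fderiv_eq, fderiv_comp_add_right (f := fun x => W.slope (snocEquiv d (x, g x))),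
    add_sub_cancel, ← this, hgp]

/-- With an invertible derivative the map carries neighbourhoods to neighbourhoods, so the value
would be interior to the range. -/
theorem SmoothnessHypothesis.det_eq_zero_of_mem_frontier (hW : W.SmoothnessHypothesis)
    (hp : IsLocalHomeomorph W.proj) {z : W.V₁}
    (hz : W.gaussMap z ∈ frontier (Set.range W.gaussMap)) :
    (fderiv ℝ (W.gaussMap ∘ (torusChart hp z).symm) (torusChart hp z z)).det = 0 := by
  by_contra hdet
  refine hz.2 (mem_interior_iff_mem_nhds.2 ?_)
  have hd := (hW.contDiffAt_gaussMap_chart hp z).hasStrictFDerivAt (by simp)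
  have hsurj : (fderiv ℝ (W.gaussMap ∘ (torusChart hp z).symm) (torusChart hp z z)).range = ⊤ :=
    (LinearMap.isUnit_iff_range_eq_top _).1
      ((LinearMap.isUnit_iff_isUnit_det _).2 (isUnit_iff_ne_zero.2 hdet))
  have hm := hd.map_nhds_eq_of_surj hsurj
  rw [Function.comp_apply, (torusChart hp z).left_inv (mem_torusChart_source hp z)] at hm
  rw [← hm, mem_map]
  exact Eventually.of_forall fun x => ⟨_, rfl⟩

/-- The field is (μ, 1) normalized; its last entry 1 keeps it nonzero everywhere. -/
theorem SmoothnessHypothesis.exists_isUnitNormalField (hW : W.SmoothnessHypothesis) :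
    ∃ N, IsUnitNormalField W.logV₁ N := by
  have hne : ∀ θ, snocEquiv d (W.slope θ, 1) ≠ 0 := fun θ h => by
    have := congrArg (fun v => v (Fin.last d)) h
    simp at this
  refine ⟨fun θ => ‖snocEquiv d (W.slope θ, 1)‖⁻¹ • snocEquiv d (W.slope θ, 1), ?_, ?_, ?_⟩
  · intro θ hθ
    have h : ContDiffAt ℝ ∞ (fun θ => snocEquiv d (W.slope θ, 1)) θ :=
      (snocEquiv d).contDiff.contDiffAt.comp θ ((hW.contDiffAt_slope hθ).prodMk contDiffAt_const)
    exact (((h.norm ℝ (hne θ)).inv (norm_ne_zero_iff.2 (hne θ))).smul h).contDiffWithinAt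
  · intro θ _
    exact norm_smul_inv_norm (𝕜 := ℝ) (hne θ)
  · intro θ hθ v hv
    obtain ⟨p, rfl⟩ := (snocEquiv d).surjective θ
    obtain ⟨g, -, hgp, hl⟩ := hW.exists_isLocalGraph hθ
    have := hl.mem_tangentSpaceOf_iff v
    rw [hgp] at this
    obtain ⟨w, rfl⟩ := this.1 hv
    rw [inner_smul_left, inner_snocEquiv]
    simp

theorem SmoothnessHypothesis.projGaussMap_eq (hW : W.SmoothnessHypothesis) (z : W.V₁) :
    ∃ hz : W.logGradQ (torusIncl (z : Torus (d + 1))) ≠ 0,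
      W.projGaussMap (torusIncl (z : Torus (d + 1))) hz = affinePoint (W.gaussMap z) := by
  have hL := hW.logGradQ_last_ne_zero z.2
  refine ⟨fun h => hL (congrFun h _), ?_⟩
  obtain ⟨θ, hθ⟩ := torusExp_surjective (z : Torus (d + 1))
  have hmem : θ ∈ W.logV₁ := by
    change torusExp θ ∈ W.V₁
    rw [hθ]
    exact z.2
  rw [projGaussMap, affinePoint, Projectivization.mk_eq_mk_iff']
  refine ⟨W.logGradQ (torusIncl (z : Torus (d + 1))) (Fin.last d), ?_⟩
  ext i
  induction i using Fin.lastCases with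
  | last => simp
  | cast j =>
    have := hW.logGradQ_castSucc hmem j
    rw [hθ] at this
    rw [this, gaussMap_eq_slope hθ]
    simp [mul_comm]

theorem injective_fderiv_torusIncl_torusExp (x : EuclideanSpace ℝ (Fin d)) :
    Function.Injective
      (fderiv ℝ (fun θ : EuclideanSpace ℝ (Fin d) => torusIncl (torusExp θ)) x) := by
  rw [(hasFDerivAt_torusIncl_torusExp x).fderiv]
  intro v w h
  ext i
  have := congrFun h i
  simpa [torusIncl_ne_zero] using this

theorem torusIncl_proj_chart_symm (hp : IsLocalHomeomorph W.proj) (z : W.V₁) :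
    ((fun w : W.V₁ => torusIncl (W.proj w)) ∘ (torusChart hp z).symm)
      =ᶠ[𝓝 (torusChart hp z z)] fun x => torusIncl (torusExp x) := by
  filter_upwards [(torusChart hp z).open_target.mem_nhds
    ((torusChart hp z).map_source (mem_torusChart_source hp z))] with x hx
  rw [Function.comp_apply, ← torusExp_torusChart hp z ((torusChart hp z).map_target hx),
    (torusChart hp z).right_inv hx]

theorem injective_fderiv_torusIncl_proj_chart (hp : IsLocalHomeomorph W.proj) (z : W.V₁) :
    Function.Injective (fderiv ℝ ((fun w : W.V₁ => torusIncl (W.proj w)) ∘ (torusChart hp z).symm)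
      (torusChart hp z z)) := by
  rw [(torusIncl_proj_chart_symm hp z).fderiv_eq]
  exact injective_fderiv_torusIncl_torusExp _

/-- Forgetting the last coordinate turns the inclusion into π, whose differential is already
injective. -/
theorem SmoothnessHypothesis.injective_fderiv_torusIncl_chart (hW : W.SmoothnessHypothesis)
    (hp : IsLocalHomeomorph W.proj) (z : W.V₁) :
    Function.Injective (fderiv ℝ
      ((fun z : W.V₁ => torusIncl (z : Torus (d + 1))) ∘ (torusChart hp z).symm)
      (torusChart hp z z)) := by
  set L : (Fin (d + 1) → ℂ) →L[ℝ] (Fin d → ℂ) :=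
    ContinuousLinearMap.pi fun i => .proj i.castSucc
  have h1 := L.hasFDerivAt.comp (torusChart hp z z)
    ((hW.contDiffAt_torusIncl_chart hp z).differentiableAt (by simp)).hasFDerivAt
  have h2 := injective_fderiv_torusIncl_proj_chart hp z
  rw [show (fun w : W.V₁ => torusIncl (W.proj w)) ∘ (torusChart hp z).symm =
    L ∘ (fun z : W.V₁ => torusIncl (z : Torus (d + 1))) ∘ (torusChart hp z).symm from rfl,
    h1.fderiv] at h2
  exact Function.Injective.of_comp (f := L) h2

theorem contMDiff_proj (hp : IsLocalHomeomorph W.proj) :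
    @ContMDiff ℝ _ _ _ _ _ _ (𝓡 d) W.V₁ _ (torusChartedSpace hp) _ _ _ _ _ (torusModel d)
      (Torus d) _ _ ∞ W.proj := by
  let := torusChartedSpace hp
  have := isManifold_torusChartedSpace hp
  refine contMDiff_torus fun i z => ?_
  have h1 : ContMDiffAt (𝓡 d) 𝓘(ℝ, EuclideanSpace ℝ (Fin d)) ∞ (extChartAt (𝓡 d) z) z :=
    contMDiffAt_extChartAt
  have h2 : ContMDiffAt (𝓡 d) 𝓘(ℝ, ℝ) ∞ (fun w => extChartAt (𝓡 d) z w i) z :=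
    (EuclideanSpace.proj (𝕜 := ℝ) i).contMDiff.contMDiffAt.comp z h1
  refine (contMDiff_circleExp.contMDiffAt.comp z h2).congr_of_eventuallyEq ?_
  filter_upwards [(torusChart hp z).open_source.mem_nhds (mem_torusChart_source hp z)] with w hw
  exact (congrFun (torusExp_torusChart hp z hw) i).symm

/-- By compactness the local homeomorphisms are coverings. On each torus π is a surjective
homomorphism, so every fibre is a coset of its kernel, whose order is the number of sheets. -/
theorem exists_torus_decomposition (hp : IsLocalHomeomorph W.proj) :
    ∃ (s : ℕ) (n : Fin s → ℕ) (h : (Σ _ : Fin s, Torus d) ≃ₜ W.V₁), ∀ j : Fin s,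
      0 < n j ∧
      ContMDiff (torusModel d) (torusModel d) ∞ (fun t : Torus d => W.proj (h ⟨j, t⟩)) ∧
      IsCoveringMap (fun t : Torus d => W.proj (h ⟨j, t⟩)) ∧
      ∀ x : Torus d, Nat.card {t : Torus d // W.proj (h ⟨j, t⟩) = x} = n j := by
  have : CompactSpace W.V₁ := isCompact_iff_compactSpace.1 W.isCompact_V₁
  obtain ⟨s, B, h, hB⟩ :=
    exists_homeomorph_sigma_torus (isLocalHomeomorph_iff_isCoveringMap.1 hp)
  refine ⟨s, fun j => Nat.card (torusMonomial (B j)).ker, h, fun j => ?_⟩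
  have heq : (fun t : Torus d => W.proj (h ⟨j, t⟩)) = torusMonomial (B j) := funext (hB j).1
  have hcov : IsCoveringMap fun t : Torus d => W.proj (h ⟨j, t⟩) :=
    isLocalHomeomorph_iff_isCoveringMap.1
      (hp.comp (h.isLocalHomeomorph.comp IsOpenEmbedding.sigmaMk.isLocalHomeomorph))
  refine ⟨?_, ?_, hcov, fun x => ?_⟩
  · rw [heq] at hcov
    have : Finite (torusMonomial (B j)).ker := hcov.finite_fiber 1
    exact Nat.card_pos
  · rw [heq]
    exact contMDiff_torusMonomial _
  · simp only [(hB j).1]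
    exact Nat.card_congr (MonoidHom.fiberEquivKerOfSurjective (hB j).2 x)

end QuantumWalk

end

theorem mainTheorem4 {d k : ℕ} (hd : 1 ≤ d) (hk : d + 1 ≤ k) (W : QuantumWalk d k)
    (hW : W.SmoothnessHypothesis) :
    -- `∂Q/∂y` does not vanish on `𝒱₁`
    (∀ z ∈ W.V₁, W.gradQ (torusIncl z) (Fin.last d) ≠ 0) ∧
    -- `𝒱₁` is compact, and an embedded smooth `d`-manifold (in its subspace topology)
    IsCompact W.V₁ ∧
    ∃ (_ : ChartedSpace (EuclideanSpace ℝ (Fin d)) W.V₁) (_ : IsManifold (𝓡 d) ∞ W.V₁),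
      ContMDiff (𝓡 d) 𝓘(ℝ, Fin (d + 1) → ℂ) ∞
        (fun z : W.V₁ => torusIncl (z : Torus (d + 1))) ∧
      (∀ z : W.V₁, Function.Injective
        (mfderiv (𝓡 d) 𝓘(ℝ, Fin (d + 1) → ℂ)
          (fun z : W.V₁ => torusIncl (z : Torus (d + 1))) z)) ∧
      -- `π` is smooth and nonsingular
      ContMDiff (𝓡 d) (torusModel d) ∞ W.proj ∧
      (∀ z : W.V₁, Function.Bijective (mfderiv (𝓡 d) (torusModel d) W.proj z)) ∧
      -- `𝒱₁` is a disjoint union of `s` tori, the `j`-th covering `Tᵈ` smoothly `n j` times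
      (∃ (s : ℕ) (n : Fin s → ℕ) (h : (Σ _ : Fin s, Torus d) ≃ₜ W.V₁), ∀ j : Fin s,
        0 < n j ∧
        ContMDiff (torusModel d) (torusModel d) ∞ (fun t : Torus d => W.proj (h ⟨j, t⟩)) ∧
        IsCoveringMap (fun t : Torus d => W.proj (h ⟨j, t⟩)) ∧
        ∀ x : Torus d, Nat.card {t : Torus d // W.proj (h ⟨j, t⟩) = x} = n j) ∧
      -- the logarithmic Gauss map takes `𝒱₁` to `ℝᵈ ⊂ ℂℙᵈ`, where it is the smooth map `μ`
      (∀ z : W.V₁, ∃ hz : W.logGradQ (torusIncl z) ≠ 0,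
        W.projGaussMap (torusIncl z) hz = affinePoint (W.gaussMap z)) ∧
      ContMDiff (𝓡 d) 𝓘(ℝ, EuclideanSpace ℝ (Fin d)) ∞ W.gaussMap ∧
      -- the hypersurface `-i log 𝒱₁` has a smooth field of unit normals, and for any of them:
      (∃ N, IsUnitNormalField W.logV₁ N) ∧
      ∀ N, IsUnitNormalField W.logV₁ N →
        ∀ (z : W.V₁) (θ : EuclideanSpace ℝ (Fin (d + 1))), torusExp θ = z →
          -- `κ` vanishes exactly where the Jacobian determinant of `μ` does
          (gaussKroneckerCurvature W.logV₁ N θ = 0 ↔ W.gaussJacobian z = 0) ∧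
          -- `κ` vanishes over the boundary of the range of `μ`
          (W.gaussMap z ∈ frontier (Set.range W.gaussMap) →
            gaussKroneckerCurvature W.logV₁ N θ = 0) := by
  have hp : IsLocalHomeomorph W.proj := hW.isLocalHomeomorph_proj
  let cs : ChartedSpace (EuclideanSpace ℝ (Fin d)) W.V₁ := torusChartedSpace hp
  have hman : IsManifold (𝓡 d) ∞ W.V₁ := isManifold_torusChartedSpace hp
  have hincl : ContMDiff (𝓡 d) 𝓘(ℝ, Fin (d + 1) → ℂ) ∞
      (fun z : W.V₁ => torusIncl (z : Torus (d + 1))) := fun z =>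
    contMDiffAt_of_contDiffAt_chartAt_symm (hW.contDiffAt_torusIncl_chart hp z)
  have hgauss : ContMDiff (𝓡 d) 𝓘(ℝ, EuclideanSpace ℝ (Fin d)) ∞ W.gaussMap := fun z =>
    contMDiffAt_of_contDiffAt_chartAt_symm (hW.contDiffAt_gaussMap_chart hp z)
  have hjac : ∀ z, W.gaussJacobian z =
      (fderiv ℝ (W.gaussMap ∘ (torusChart hp z).symm) (torusChart hp z z)).det := fun z => by
    rw [QuantumWalk.gaussJacobian, mfderiv_eq_fderiv_chartAt_symm
      (hgauss.mdifferentiable (by simp) z)]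
    rfl
  refine ⟨fun z hz => hW.gradQ_last_ne_zero hz, W.isCompact_V₁, cs, hman, hincl, fun z => ?_,
    QuantumWalk.contMDiff_proj hp, fun z => ?_, QuantumWalk.exists_torus_decomposition hp,
    hW.projGaussMap_eq, hgauss, hW.exists_isUnitNormalField, fun N hN z θ hθ => ⟨?_, fun hz => ?_⟩⟩
  · rw [mfderiv_eq_fderiv_chartAt_symm (hincl.mdifferentiable (by simp) z)]
    exact hW.injective_fderiv_torusIncl_chart hp z
  · have hproj := QuantumWalk.contMDiff_proj hp
    -- Composing with the inclusion into ℂᵈ reduces injectivity to the chart computation; equality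
    -- of dimensions then gives bijectivity.
    have hinj : Function.Injective (mfderiv (𝓡 d) (torusModel d) W.proj z) := by
      have hc : ContMDiff (𝓡 d) 𝓘(ℝ, Fin d → ℂ) ∞ (torusIncl ∘ W.proj) :=
        contMDiff_torusIncl.comp hproj
      have h1 := mfderiv_comp z
        ((contMDiff_torusIncl (n := ∞)).mdifferentiable (by simp) (W.proj z))
        (hproj.mdifferentiable (by simp) z)
      rw [mfderiv_eq_fderiv_chartAt_symm (hc.mdifferentiable (by simp) z)] at h1
      have h2 := QuantumWalk.injective_fderiv_torusIncl_proj_chart hp z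
      exact fun v w hvw => h2 (((DFunLike.congr_fun h1 v).trans
        (congrArg (mfderiv (torusModel d) 𝓘(ℝ, Fin d → ℂ) torusIncl (W.proj z)) hvw)).trans
        (DFunLike.congr_fun h1 w).symm)
    refine ⟨hinj, ?_⟩
    let D : EuclideanSpace ℝ (Fin d) →ₗ[ℝ] (Fin d → EuclideanSpace ℝ (Fin 1)) :=
      (mfderiv (𝓡 d) (torusModel d) W.proj z).toLinearMap
    exact (LinearMap.injective_iff_surjective_of_finrank_eq_finrank (f := D)
      (by simp [Module.finrank_pi_fintype])).1 hinj
  · rw [hW.gaussKroneckerCurvature_eq_zero_iff hp hN hθ, hjac]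
  · rw [hW.gaussKroneckerCurvature_eq_zero_iff hp hN hθ]
    exact hW.det_eq_zero_of_mem_frontier hp hz
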